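/- Let $G=(V,E)$ be a finite simple graph with treewidth $\mathrm{tw}(G)\le k$ ($k\ge 0$ an integer) and $|V|\ge 6(k+1)$. A set $S\subseteq V$ separates $A,B\subseteq V$ if every path of $G$ from $A$ to $B$ (one-vertex paths included) contains a vertex of $S$; a minimal separator of $A$ and $B$ is such a set $S$ of minimum size. Let $\Sigma\in\mathbb R^{V\times V}$ be a symmetric positive definite matrix such that $(\Sigma^{-1})_{ij}=0$ whenever $i\ne j$ and $ij\notin E$, and suppose that $\Sigma$ is generic, i.e. for all $A,B\subseteq V$ the rank of the submatrix $\Sigma_{A,B}$ (rows $A$, columns $B$) equals the minimum size of a set separating $A$ and $B$ in $G$. Let $\tau\in(0,1)$ and let $m$ be any integer with $$m\;\ge\;\max\Big(\frac{10r}{\delta^2}\log\frac{8r}{\delta^2},\ \frac{2}{\delta^2}\log\frac2\tau\Big),\qquad r=11k,\quad \delta=\tfrac1{24}$$ (the first term being $0$ if $k=0$). The procedure $\mathtt{Separator}$ works as follows. 1. Draw $m$ vertices of $V$ independently and uniformly at random, with replacement, and let $W$ be the set of the drawn vertices. 2. Among all partitions of $W$ into two disjoint sets $A,B$ with $|A|,|B|\le\frac23|W|$,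 choose one that minimizes $\mathrm{rank}(\Sigma_{A,B})$; if there is no such partition, take any partition of $W$ into two disjoint sets $A,B$. 3. Return the output of $\mathtt{ABSeparator}(A,B)$, which is the following. Put $\rho=\mathrm{rank}(\Sigma_{A,B})$ and $U=\{v\in V:\ \mathrm{rank}(\Sigma_{A\cup v,\,B\cup v})=\rho\}$. If $U=\emptyset$, return $\emptyset$. Otherwise choose some $v_0\in U$, start with $C=\{v_0\}$, go through the vertices $u\in U\setminus\{v_0\}$ in some order, replacing $C$ by $C\cup\{u\}$ whenever $\mathrm{rank}(\Sigma_{A\cup C\cup u,\,B\cup C\cup u})=\rho$, and finally return $C$. Then, with probability at least $1-\tau$ over the drawn vertices, the procedure returns a set, and, whichever way the choices left open in steps 2 and 3 are made, the returned set $S$ has the following properties: $S$ is a separator in $G$, namely a minimal separator of two disjoint sets $A,B$ with $A\cup B=W$, $|A|,|B|\le\frac23|W|$, $A\not\subseteq S$ and $B\not\subseteq S$ (in particular $G\setminus S$ is disconnected); $|S|\le k+1$; and every connected component of $G\setminus S$ has at most $0.93\,|V|$ vertices. -/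

import Mathlib

/-! ### Separators, tree decompositions, treewidth -/

/-- `S` separates `A` and `B` in `G`: every path of `G` from a vertex of `A` to a vertex of `B`
contains a vertex of `S`. The sets `A` and `B` may intersect; because of the one-vertex paths,
`A ∩ B` is then contained in every separator. -/
def Separates {V : Type*} (G : SimpleGraph V) (A B S : Finset V) : Prop :=
  ∀ a ∈ A, ∀ b ∈ B, ∀ p : G.Walk a b, p.IsPath → ∃ v ∈ p.support, v ∈ S

/-- `S` is a minimal separator of `A` and `B`, that is, a separator of minimum size. -/
def IsMinSeparator {V : Type*} (G : SimpleGraph V) (A B S : Finset V) : Prop :=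
  Separates G A B S ∧ ∀ S' : Finset V, Separates G A B S' → S.card ≤ S'.card

/-- The tree `T` with bags `bag i`, one for each vertex `i` of `T`, is a tree decomposition
of `G`. -/
structure IsTreeDecomposition {V ι : Type*} (G : SimpleGraph V) (T : SimpleGraph ι)
    (bag : ι → Finset V) : Prop where
  isTree : T.IsTree
  cover : ∀ v : V, ∃ i, v ∈ bag i
  path : ∀ (v : V) (i j : ι), v ∈ bag i → v ∈ bag j →
    ∀ p : T.Walk i j, p.IsPath → ∀ l ∈ p.support, v ∈ bag l
  edge : ∀ u v : V, G.Adj u v → ∃ i, u ∈ bag i ∧ v ∈ bag i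

/-- The treewidth of `G`: the least `w` such that `G` has a (finite) tree decomposition all of
whose bags have at most `w + 1` elements. For a finite graph such a `w` always exists. -/
noncomputable def treewidth {V : Type*} (G : SimpleGraph V) : ℕ :=
  sInf {w : ℕ | ∃ (n : ℕ) (T : SimpleGraph (Fin n)) (bag : Fin n → Finset V),
    IsTreeDecomposition G T bag ∧ ∀ i, (bag i).card ≤ w + 1}

/-! ### Covariance matrices -/

/-- The set `M(G)` of symmetric positive definite matrices whose inverse `K` satisfies
`K i j = 0` for all non-adjacent `i ≠ j`. -/
def covMatrices {V : Type*} [Fintype V] [DecidableEq V] (G : SimpleGraph V) :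
    Set (Matrix V V ℝ) :=
  {cov | cov.PosDef ∧ ∀ i j : V, i ≠ j → ¬ G.Adj i j → cov⁻¹ i j = 0}

/-- The rank of the submatrix of `cov` with rows in `A` and columns in `B`. -/
noncomputable def subRank {V : Type*} (cov : Matrix V V ℝ) (A B : Finset V) : ℕ :=
  (cov.submatrix (fun a : A => (a : V)) (fun b : B => (b : V))).rank

/-- `cov` is generic for `G`: for all vertex sets `A` and `B`, the rank of the submatrix with
rows in `A` and columns in `B` is the minimum size of a separator of `A` and `B` in `G`. -/
def IsGeneric {V : Type*} (G : SimpleGraph V) (cov : Matrix V V ℝ) : Prop :=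
  ∀ A B : Finset V, IsLeast {s : ℕ | ∃ S : Finset V, Separates G A B S ∧ S.card = s}
    (subRank cov A B)

/-! ### The procedure `ABSeparator` -/

section Procedures

variable {V : Type*} [DecidableEq V]

/-- The set `U` computed by the first loop: all `v` such that adding `v` to the rows and to the
columns leaves the rank unchanged. -/
noncomputable def separatorVertices [Fintype V] (cov : Matrix V V ℝ) (A B : Finset V) :
    Finset V :=
  Finset.univ.filter fun v => subRank cov (insert v A) (insert v B) = subRank cov A B

/-- The second loop: go through the vertices of the list in the given order, starting from the
set `C`, and add `u` to the current set whenever this leaves the rank equal to that of `A, B`. -/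
noncomputable def separatorLoop (cov : Matrix V V ℝ) (A B C : Finset V) (order : List V) :
    Finset V :=
  order.foldl
    (fun C u =>
      if subRank cov (A ∪ insert u C) (B ∪ insert u C) = subRank cov A B
      then insert u C else C)
    C

/-- `ABSeparatorReturns cov A B C`: the set `C` is a possible return value of the procedure
`ABSeparator(A, B)`. The choice of the start vertex `v₀ ∈ U` and the order in which the second
loop runs through `U \ {v₀}` are left open by the procedure; every choice is admitted.
If `U` is empty then nothing is ever added and the empty set is returned. -/
inductive ABSeparatorReturns [Fintype V] (cov : Matrix V V ℝ) (A B : Finset V) :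
    Finset V → Prop
  | empty (hU : separatorVertices cov A B = ∅) : ABSeparatorReturns cov A B ∅
  | run (v₀ : V) (hv₀ : v₀ ∈ separatorVertices cov A B)
      (order : List V) (hnodup : order.Nodup)
      (horder : ∀ u, u ∈ order ↔ u ∈ (separatorVertices cov A B).erase v₀) :
      ABSeparatorReturns cov A B (separatorLoop cov A B {v₀} order)

/-! ### The procedure `Separator` -/

/-- `A`, `B` is a partition of `W` into two disjoint sets. -/
def IsSplit (W A B : Finset V) : Prop :=
  A ∪ B = W ∧ Disjoint A B

/-- `A`, `B` is a partition of `W` into two sets of size at most `2|W|/3`. -/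
def IsBalancedSplit (W A B : Finset V) : Prop :=
  IsSplit W A B ∧ (A.card : ℝ) ≤ 2 / 3 * W.card ∧ (B.card : ℝ) ≤ 2 / 3 * W.card

/-- `A`, `B` is a possible result of the exhaustive search: a balanced split of `W` that minimizes
the rank among all balanced splits of `W`, or any split of `W` if there is no balanced one. -/
def IsSearchResult (cov : Matrix V V ℝ) (W A B : Finset V) : Prop :=
  (IsBalancedSplit W A B ∧
    ∀ A' B' : Finset V, IsBalancedSplit W A' B' → subRank cov A B ≤ subRank cov A' B') ∨
  ((¬ ∃ A' B' : Finset V, IsBalancedSplit W A' B') ∧ IsSplit W A B)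

/-- `SeparatorReturns cov ω S`: the set `S` is a possible return value of the procedure
`Separator` when the sampled vertices are `ω 0, …, ω (m - 1)`, so that `W` is the set of
these vertices. -/
def SeparatorReturns [Fintype V] (cov : Matrix V V ℝ) {m : ℕ} (ω : Fin m → V)
    (S : Finset V) : Prop :=
  ∃ A B : Finset V, IsSearchResult cov (Finset.univ.image ω) A B ∧ ABSeparatorReturns cov A B S

end Procedures

/-- The lower bound `max (10 r / δ² · log (8 r / δ²)) (2 / δ² · log (2 / τ))` on the number of
sampled vertices. -/
noncomputable def sampleSizeBound (r δ τ : ℝ) : ℝ :=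
  max (10 * r / δ ^ 2 * Real.log (8 * r / δ ^ 2)) (2 / δ ^ 2 * Real.log (2 / τ))

/-- What the procedure has to find from the sampled set `W`: a set `S` that is a minimal separator
of the two parts of a balanced split of `W`, neither of which is swallowed by `S`
(so `S` disconnects `G`), such that `|S| ≤ k + 1` and every connected component of `G \ S` has
at most `0.93 |V|` vertices. -/
def IsGoodSeparator {V : Type*} [Fintype V] [DecidableEq V] (G : SimpleGraph V) (k : ℕ)
    (W S : Finset V) : Prop :=
  (∃ A B : Finset V, IsBalancedSplit W A B ∧ IsMinSeparator G A B S ∧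
    (A \ S).Nonempty ∧ (B \ S).Nonempty) ∧
  S.card ≤ k + 1 ∧
  ∀ C : (G.induce ((S : Set V)ᶜ)).ConnectedComponent,
    (C.supp.ncard : ℝ) ≤ 0.93 * Fintype.card V

/-! Genericity turns every rank into a minimum separator size. A vertex lying in both sets belongs
to each of their separators, so adding `C` to rows and columns keeps the rank exactly when some
minimum separator of `A`, `B` contains `C` (`subRank_union_eq_iff`). The greedy loop therefore grows
a subset of a minimum separator until it is one.

If the treewidth is at most `k`, some bag of at most `k + 1` vertices leaves no component with more
than half of `W` (`exists_balanced_bag`). Grouping the components yields a balanced split separated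
by that bag, so the minimizing split has rank at most `k + 1`. Both of its parts have at least `|W|
/ 3` elements, hence neither lies in `S` once `|W| > 3(k + 1)`.

A component `C` of `G \ S` cannot meet both parts, so at least a third of `W` lies outside `C`. If
`C` had more than `0.93 n` vertices (`n = |V|`), a set of fewer than `0.07 n` vertices would catch a
third of the sample. To exclude this for all `S` and `C` at once, the complements `Cᶜ` are covered
by few sets of at most `0.08 n` vertices (`exists_covering_family`), and a Chernoff bound with a
union bound is applied to those. The remaining danger is a small `W` caused by repeated draws. If `m
< 2n`, then `|W| > 3m/10` with high probability, while each covering set receives fewer than `m/10`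
draws. If `m ≥ 2n`, then `|W| > n/2` with high probability, which alone exceeds three times `0.07
n`. -/

/-! ### Minimum separators, ranks and the greedy loop -/

section Separators

variable {V : Type*} {G : SimpleGraph V}

theorem Separates.exists_mem_support {A B S : Finset V} (h : Separates G A B S) {a b : V}
    (ha : a ∈ A) (hb : b ∈ B) (p : G.Walk a b) : ∃ v ∈ p.support, v ∈ S := by
  classical
  obtain ⟨v, hv, hS⟩ := h a ha b hb p.bypass p.bypass_isPath
  exact ⟨v, p.support_bypass_subset_support hv, hS⟩

theorem Separates.mono {A B A' B' S : Finset V} (h : Separates G A B S) (hA : A' ⊆ A)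
    (hB : B' ⊆ B) : Separates G A' B' S :=
  fun a ha b hb p hp => h a (hA ha) b (hB hb) p hp

theorem Separates.inter_subset {A B S : Finset V} (h : Separates G A B S) {v : V}
    (hA : v ∈ A) (hB : v ∈ B) : v ∈ S := by
  obtain ⟨x, hx, hS⟩ := h.exists_mem_support hA hB SimpleGraph.Walk.nil
  simp only [SimpleGraph.Walk.support_nil, List.mem_singleton] at hx
  exact hx ▸ hS

theorem IsMinSeparator.card_eq_subRank {cov : Matrix V V ℝ} (hgen : IsGeneric G cov)
    {A B S : Finset V} (h : IsMinSeparator G A B S) : S.card = subRank cov A B := by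
  obtain ⟨⟨S', hS', hc⟩, hle⟩ := hgen A B
  exact le_antisymm (hc ▸ h.2 S' hS') (hle ⟨S, h.1, rfl⟩)

theorem Separates.subRank_le {cov : Matrix V V ℝ} (hgen : IsGeneric G cov)
    {A B S : Finset V} (h : Separates G A B S) : subRank cov A B ≤ S.card :=
  (hgen A B).2 ⟨S, h, rfl⟩

theorem exists_isMinSeparator {cov : Matrix V V ℝ} (hgen : IsGeneric G cov) (A B : Finset V) :
    ∃ S, IsMinSeparator G A B S := by
  obtain ⟨⟨S, hS, hc⟩, -⟩ := hgen A B
  exact ⟨S, hS, fun S' hS' => hc.trans_le (hS'.subRank_le hgen)⟩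

variable [DecidableEq V]

/-- Adding `C` to both sides keeps the rank iff `C` is part of a minimal separator. -/
theorem subRank_union_eq_iff {cov : Matrix V V ℝ} (hgen : IsGeneric G cov) (A B C : Finset V) :
    subRank cov (A ∪ C) (B ∪ C) = subRank cov A B ↔ ∃ S, IsMinSeparator G A B S ∧ C ⊆ S := by
  constructor
  · intro h
    -- A smallest separator of the enlarged sets contains `C` because of the one-vertex paths, and
    -- the rank equality makes it minimum for `A`, `B` too.
    obtain ⟨⟨S, hS, hc⟩, -⟩ := hgen (A ∪ C) (B ∪ C)
    refine ⟨S, ⟨hS.mono Finset.subset_union_left Finset.subset_union_left, fun S' hS' => ?_⟩,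
      fun v hv => hS.inter_subset (Finset.mem_union_right _ hv) (Finset.mem_union_right _ hv)⟩
    rw [hc, h]
    exact hS'.subRank_le hgen
  · rintro ⟨S, hS, hCS⟩
    have hsep : Separates G (A ∪ C) (B ∪ C) S := by
      intro a ha b hb p hp
      rcases Finset.mem_union.1 ha with ha | ha
      · rcases Finset.mem_union.1 hb with hb | hb
        · exact hS.1 a ha b hb p hp
        · exact ⟨b, p.end_mem_support, hCS hb⟩
      · exact ⟨a, p.start_mem_support, hCS ha⟩
    refine le_antisymm ((hsep.subRank_le hgen).trans_eq (hS.card_eq_subRank hgen)) ?_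
    obtain ⟨⟨S', hS', hc⟩, -⟩ := hgen (A ∪ C) (B ∪ C)
    rw [← hc]
    exact (hS'.mono Finset.subset_union_left Finset.subset_union_left).subRank_le hgen

theorem subset_separatorLoop (cov : Matrix V V ℝ) (A B : Finset V) (order : List V) :
    ∀ C, C ⊆ separatorLoop cov A B C order := by
  induction order with
  | nil => exact fun C => subset_rfl
  | cons u l ih =>
    intro C
    refine Finset.Subset.trans ?_ (ih _)
    dsimp only
    split_ifs
    · exact Finset.subset_insert _ _
    · exact subset_rfl

/-- The invariant of the greedy loop: an accepted vertex leaves the current set extendable to a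
minimum separator, possibly a different one than before. -/
theorem separatorLoop_subset_isMinSeparator {cov : Matrix V V ℝ} (hgen : IsGeneric G cov)
    (A B : Finset V) (order : List V) : ∀ C, (∃ S, IsMinSeparator G A B S ∧ C ⊆ S) →
      ∃ S, IsMinSeparator G A B S ∧ separatorLoop cov A B C order ⊆ S := by
  induction order with
  | nil => exact fun C h => h
  | cons u l ih =>
    intro C h
    refine ih _ ?_
    dsimp only
    split_ifs with hr
    · exact (subRank_union_eq_iff hgen A B _).1 hr
    · exact h

/-- When `u ∈ S` is examined, the current set is still inside `S`, so `S` itself witnesses that `u`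
may be added. No element of `S` in the list is rejected. -/
theorem mem_separatorLoop {cov : Matrix V V ℝ} (hgen : IsGeneric G cov)
    {A B S : Finset V} (hS : IsMinSeparator G A B S) (order : List V) :
    ∀ C, separatorLoop cov A B C order ⊆ S → ∀ u ∈ order, u ∈ S →
      u ∈ separatorLoop cov A B C order := by
  induction order with
  | nil => simp
  | cons w l ih =>
    intro C hC u hu huS
    rcases List.mem_cons.1 hu with rfl | hu
    · have hCS : C ⊆ S := (subset_separatorLoop cov A B (u :: l) C).trans hC
      have hr : subRank cov (A ∪ insert u C) (B ∪ insert u C) = subRank cov A B :=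
        (subRank_union_eq_iff hgen A B _).2 ⟨S, hS, Finset.insert_subset huS hCS⟩
      have : separatorLoop cov A B C (u :: l) = separatorLoop cov A B (insert u C) l := by
        change List.foldl _ (if _ then _ else _) l = _
        rw [if_pos hr]
        rfl
      rw [this]
      exact subset_separatorLoop cov A B l _ (Finset.mem_insert_self _ _)
    · exact ih _ hC u hu huS

theorem mem_separatorVertices_iff [Fintype V] {cov : Matrix V V ℝ} (hgen : IsGeneric G cov)
    {A B : Finset V} {v : V} :
    v ∈ separatorVertices cov A B ↔ ∃ S, IsMinSeparator G A B S ∧ v ∈ S := by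
  have h := subRank_union_eq_iff hgen A B {v}
  rw [Finset.union_comm A, Finset.union_comm B, ← Finset.insert_eq, ← Finset.insert_eq] at h
  simpa [separatorVertices] using h

/-- The comparison separator `S` is chosen only after the loop, as one containing its final value.
All elements of `S` lie in `U`, hence were examined and accepted. If `U` is empty, the minimum
separator is empty. -/
theorem ABSeparatorReturns.isMinSeparator [Fintype V] {cov : Matrix V V ℝ}
    (hgen : IsGeneric G cov) {A B C : Finset V} (h : ABSeparatorReturns cov A B C) :
    IsMinSeparator G A B C := by
  cases h with
  | empty hU =>
    obtain ⟨S, hS⟩ := exists_isMinSeparator hgen A B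
    have : S = ∅ := Finset.eq_empty_of_forall_notMem fun v hv => by
      have := (mem_separatorVertices_iff hgen).2 ⟨S, hS, hv⟩
      simp [hU] at this
    exact this ▸ hS
  | run v₀ hv₀ order hnodup horder =>
    obtain ⟨S₀, hS₀, hv₀S⟩ := (mem_separatorVertices_iff hgen).1 hv₀
    obtain ⟨S, hS, hsub⟩ := separatorLoop_subset_isMinSeparator hgen A B order {v₀}
      ⟨S₀, hS₀, Finset.singleton_subset_iff.2 hv₀S⟩
    have : separatorLoop cov A B {v₀} order = S := by
      refine hsub.antisymm fun u hu => ?_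
      by_cases huv : u = v₀
      · exact huv ▸ subset_separatorLoop cov A B order {v₀} (Finset.mem_singleton_self _)
      · exact mem_separatorLoop hgen hS order _ hsub u ((horder u).2 (Finset.mem_erase.2
          ⟨huv, (mem_separatorVertices_iff hgen).2 ⟨S, hS, hu⟩⟩)) hu
    exact this ▸ hS

theorem exists_ABSeparatorReturns [Fintype V] (cov : Matrix V V ℝ) (A B : Finset V) :
    ∃ C, ABSeparatorReturns cov A B C := by
  rcases (separatorVertices cov A B).eq_empty_or_nonempty with h | ⟨v, hv⟩
  · exact ⟨∅, .empty h⟩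
  · exact ⟨_, .run v hv ((separatorVertices cov A B).erase v).toList (Finset.nodup_toList _)
      (by simp)⟩

theorem exists_isSearchResult [Fintype V] (cov : Matrix V V ℝ) {W : Finset V}
    (h : ∃ A B : Finset V, IsBalancedSplit W A B) : ∃ A B, IsSearchResult cov W A B := by
  classical
  obtain ⟨A, B, hAB⟩ := h
  obtain ⟨p, hp, hmin⟩ := Finset.exists_min_image
    (Finset.univ.filter fun p : Finset V × Finset V => IsBalancedSplit W p.1 p.2)
    (fun p => subRank cov p.1 p.2) ⟨(A, B), by simpa using hAB⟩
  refine ⟨p.1, p.2, Or.inl ⟨(Finset.mem_filter.1 hp).2, fun A' B' h' => ?_⟩⟩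
  exact hmin (A', B') (by simpa using h')

end Separators

/-! ### Connected sets and components of `G \ S` -/

section Connectivity

variable {V : Type*} (G : SimpleGraph V)

/-- `P` is nonempty and induces a connected subgraph of `G`. -/
def IsConnSet (P : Finset V) : Prop :=
  P.Nonempty ∧ ∀ T ⊆ P, T.Nonempty → (∀ x ∈ T, ∀ y ∈ P, G.Adj x y → y ∈ T) → P ⊆ T

/-- Some walk from `u` to `v` avoids `S`. -/
def ReachAvoiding (S : Finset V) (u v : V) : Prop :=
  ∃ p : G.Walk u v, ∀ x ∈ p.support, x ∉ S

open Classical in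
/-- The component of `v` in `G \ S` (empty if `v ∈ S`). -/
noncomputable def compAvoiding [Fintype V] (S : Finset V) (v : V) : Finset V :=
  Finset.univ.filter (ReachAvoiding G S v)

variable {G}

theorem isConnSet_singleton (v : V) : IsConnSet G {v} := by
  refine ⟨Finset.singleton_nonempty v, fun T hT hne _ => ?_⟩
  rw [Finset.Nonempty.subset_singleton_iff hne] at hT
  exact hT.ge

theorem ReachAvoiding.symm {S : Finset V} {u v : V} (h : ReachAvoiding G S u v) :
    ReachAvoiding G S v u := by
  obtain ⟨p, hp⟩ := h
  exact ⟨p.reverse, by simpa using hp⟩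

theorem ReachAvoiding.trans {S : Finset V} {u v w : V} (h : ReachAvoiding G S u v)
    (h' : ReachAvoiding G S v w) : ReachAvoiding G S u w := by
  obtain ⟨p, hp⟩ := h
  obtain ⟨q, hq⟩ := h'
  refine ⟨p.append q, fun x hx => ?_⟩
  rcases SimpleGraph.Walk.mem_support_append_iff _ _ |>.1 hx with h | h
  · exact hp x h
  · exact hq x h

theorem reachAvoiding_self {S : Finset V} {v : V} (h : v ∉ S) : ReachAvoiding G S v v :=
  ⟨SimpleGraph.Walk.nil, by simpa using h⟩

theorem ReachAvoiding.of_adj {S : Finset V} {u v : V} (h : G.Adj u v) (hu : u ∉ S)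
    (hv : v ∉ S) : ReachAvoiding G S u v :=
  ⟨h.toWalk, by simp [hu, hv]⟩

theorem ReachAvoiding.notMem {S : Finset V} {u v : V} (h : ReachAvoiding G S u v) : v ∉ S := by
  obtain ⟨p, hp⟩ := h
  exact hp v p.end_mem_support

theorem ReachAvoiding.mem_of_closed {S T : Finset V}
    (hcl : ∀ x ∈ T, ∀ y, G.Adj x y → y ∉ S → y ∈ T) {u v : V} (h : ReachAvoiding G S u v)
    (hu : u ∈ T) : v ∈ T := by
  obtain ⟨p, hp⟩ := h
  induction p with
  | nil => exact hu
  | cons h p ih =>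
    exact ih (hcl _ hu _ h (hp _ (by simp))) fun x hx => hp x (by simp [hx])

section

variable [Fintype V]

theorem mem_compAvoiding {S : Finset V} {u v : V} :
    u ∈ compAvoiding G S v ↔ ReachAvoiding G S v u := by
  simp [compAvoiding]

theorem disjoint_compAvoiding (S : Finset V) (v : V) : Disjoint (compAvoiding G S v) S :=
  Finset.disjoint_left.2 fun _ hu => (mem_compAvoiding.1 hu).notMem

theorem compAvoiding_closed {S : Finset V} {v x y : V} (hx : x ∈ compAvoiding G S v)
    (h : G.Adj x y) (hy : y ∉ S) : y ∈ compAvoiding G S v := by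
  rw [mem_compAvoiding] at hx ⊢
  exact hx.trans (.of_adj h hx.notMem hy)

theorem isConnSet_compAvoiding {S : Finset V} {v : V} (hv : v ∉ S) :
    IsConnSet G (compAvoiding G S v) := by
  refine ⟨⟨v, mem_compAvoiding.2 (reachAvoiding_self hv)⟩, fun T hT ⟨x, hx⟩ hcl y hy => ?_⟩
  have hx' := mem_compAvoiding.1 (hT hx)
  refine (hx'.symm.trans (mem_compAvoiding.1 hy)).mem_of_closed (fun a ha b hab hb => ?_) hx
  exact hcl a ha b (compAvoiding_closed (hT ha) hab hb) hab

theorem compAvoiding_eq {S : Finset V} {u v : V} (h : ReachAvoiding G S u v) :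
    compAvoiding G S u = compAvoiding G S v := by
  ext x
  simp only [mem_compAvoiding]
  exact ⟨h.symm.trans, h.trans⟩

theorem ncard_supp_le_card_compAvoiding {S : Finset V}
    (C : (G.induce ((S : Set V)ᶜ)).ConnectedComponent) :
    ∃ v ∉ S, C.supp.ncard ≤ (compAvoiding G S v).card := by
  obtain ⟨v, rfl⟩ := C.exists_rep
  refine ⟨v, fun h => v.2 (Finset.mem_coe.2 h), ?_⟩
  rw [← Set.ncard_coe_finset, ← Set.ncard_image_of_injective _ Subtype.val_injective]
  refine Set.ncard_le_ncard ?_ (Finset.finite_toSet _)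
  rintro _ ⟨u, hu, rfl⟩
  have hr : (G.induce ((S : Set V)ᶜ)).Reachable v u :=
    (SimpleGraph.ConnectedComponent.exact hu).symm
  obtain ⟨p⟩ := hr
  let φ : G.induce ((S : Set V)ᶜ) →g G := (SimpleGraph.Embedding.induce _).toHom
  refine Finset.mem_coe.2 (mem_compAvoiding.2 ⟨p.map φ, fun x hx => ?_⟩)
  obtain ⟨y, -, rfl⟩ := List.mem_map.1
    ((congrArg (x ∈ ·) (SimpleGraph.Walk.support_map φ p)).mp hx)
  exact fun h => y.2 (Finset.mem_coe.2 h)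

end

variable [DecidableEq V]

theorem IsConnSet.union {P Q : Finset V} (hP : IsConnSet G P) (hQ : IsConnSet G Q) {v : V}
    (hvP : v ∈ P) (hvQ : v ∈ Q) : IsConnSet G (P ∪ Q) := by
  refine ⟨⟨v, Finset.mem_union_left _ hvP⟩, fun T hT hne hcl => ?_⟩
  have key : ∀ {R : Finset V}, IsConnSet G R → R ⊆ P ∪ Q → (R ∩ T).Nonempty → R ⊆ T := by
    intro R hR hRs hn
    refine (hR.2 (R ∩ T) Finset.inter_subset_left hn fun x hx y hy hxy => ?_).trans
      Finset.inter_subset_right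
    exact Finset.mem_inter.2 ⟨hy, hcl x (Finset.mem_inter.1 hx).2 y (hRs hy) hxy⟩
  obtain ⟨x, hx⟩ := hne
  have hv : v ∈ T := by
    rcases Finset.mem_union.1 (hT hx) with h | h
    · exact key hP Finset.subset_union_left ⟨x, Finset.mem_inter.2 ⟨h, hx⟩⟩ hvP
    · exact key hQ Finset.subset_union_right ⟨x, Finset.mem_inter.2 ⟨h, hx⟩⟩ hvQ
  exact Finset.union_subset
    (key hP Finset.subset_union_left ⟨v, Finset.mem_inter.2 ⟨hvP, hv⟩⟩)
    (key hQ Finset.subset_union_right ⟨v, Finset.mem_inter.2 ⟨hvQ, hv⟩⟩)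

theorem isConnSet_pair {u v : V} (h : G.Adj u v) : IsConnSet G {u, v} := by
  refine ⟨⟨u, by simp⟩, fun T hT ⟨x, hx⟩ hcl => ?_⟩
  have hx' := hT hx
  simp only [Finset.mem_insert, Finset.mem_singleton] at hx'
  intro y hy
  simp only [Finset.mem_insert, Finset.mem_singleton] at hy
  rcases hx' with rfl | rfl <;> rcases hy with rfl | rfl
  · exact hx
  · exact hcl _ hx _ (by simp) h
  · exact hcl _ hx _ (by simp) h.symm
  · exact hx

theorem IsConnSet.insert_of_adj {P : Finset V} (hP : IsConnSet G P) {u v : V} (hu : u ∈ P)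
    (h : G.Adj u v) : IsConnSet G (insert v P) := by
  have := (isConnSet_pair h).union hP (v := u) (by simp) hu
  rwa [Finset.insert_union, Finset.singleton_union, Finset.insert_eq_of_mem
    (Finset.mem_insert_of_mem hu)] at this

theorem IsConnSet.subset_of_closed {P C : Finset V} (hP : IsConnSet G P)
    (hne : (P ∩ C).Nonempty) (hcl : ∀ x ∈ C, ∀ y ∈ P, G.Adj x y → y ∈ C) : P ⊆ C :=
  (hP.2 (P ∩ C) Finset.inter_subset_left hne fun x hx y hy hxy => Finset.mem_inter.2
    ⟨hy, hcl x (Finset.mem_inter.1 hx).2 y hy hxy⟩).trans Finset.inter_subset_right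

end Connectivity

/-! ### Balanced bags and balanced splits -/

section Treewidth

variable {V : Type*} [Fintype V] {G : SimpleGraph V}

theorem exists_isTreeDecomposition_of_treewidth_le {k : ℕ} (h : treewidth G ≤ k) :
    ∃ (n : ℕ) (T : SimpleGraph (Fin n)) (bag : Fin n → Finset V),
      IsTreeDecomposition G T bag ∧ ∀ i, (bag i).card ≤ k + 1 := by
  have hne : {w : ℕ | ∃ (n : ℕ) (T : SimpleGraph (Fin n)) (bag : Fin n → Finset V),
      IsTreeDecomposition G T bag ∧ ∀ i, (bag i).card ≤ w + 1}.Nonempty := by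
    -- The one-bag decomposition. Nonemptiness matters because `sInf ∅ = 0` would make the bound on
    -- the treewidth meaningless.
    refine ⟨Fintype.card V, 1, ⊥, fun _ => Finset.univ, ⟨?_, ?_, ?_, ?_⟩, ?_⟩
    · exact SimpleGraph.IsTree.of_subsingleton
    · simp
    · simp
    · simp
    · simp [Finset.card_univ]
  obtain ⟨n, T, bag, hT, hb⟩ := Nat.sInf_mem hne
  exact ⟨n, T, bag, hT, fun i => (hb i).trans (Nat.succ_le_succ h)⟩

theorem not_adj_of_treewidth_eq_zero (h : treewidth G ≤ 0) (u v : V) : ¬ G.Adj u v := by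
  intro huv
  obtain ⟨n, T, bag, hT, hb⟩ := exists_isTreeDecomposition_of_treewidth_le h
  obtain ⟨i, hu, hv⟩ := hT.edge u v huv
  exact huv.ne (Finset.card_le_one.1 (hb i) u hu v hv)

variable [DecidableEq V]

/-- In a tree, a map that sends each vertex to a neighbour swaps the ends of some edge. -/
theorem SimpleGraph.IsTree.exists_swap {ι : Type*} [Fintype ι] {T : SimpleGraph ι}
    (hT : T.IsTree) (f : ι → ι) (hf : ∀ i, T.Adj i (f i)) : ∃ i, f (f i) = i := by
  classical
  have hcard := hT.card_edgeFinset
  -- A tree has fewer edges than vertices, so two vertices choose the same edge.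
  obtain ⟨i, -, j, -, hij, he⟩ := Finset.exists_ne_map_eq_of_card_lt_of_maps_to
    (s := Finset.univ) (t := T.edgeFinset) (by rw [Finset.card_univ]; omega)
    (f := fun i => s(i, f i)) (fun i _ => by simpa using hf i)
  simp only [Sym2.eq_iff] at he
  rcases he with ⟨h, -⟩ | ⟨h1, h2⟩
  · exact absurd h hij
  · exact ⟨i, by rw [h2, ← h1]⟩

/-- Otherwise there would be two different paths from `j` to `x`, one starting with the edge to `i`
and one avoiding `i`. -/
theorem SimpleGraph.IsTree.not_reachAvoiding_both {ι : Type*} [DecidableEq ι]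
    {T : SimpleGraph ι} (hT : T.IsTree) {i j x : ι} (hij : T.Adj i j)
    (h : ReachAvoiding T {i} j x) (h' : ReachAvoiding T {j} i x) : False := by
  obtain ⟨p, hp⟩ := h
  obtain ⟨q, hq⟩ := h'
  have hpath : (SimpleGraph.Walk.cons hij.symm q.bypass).IsPath := by
    rw [SimpleGraph.Walk.cons_isPath_iff]
    exact ⟨q.bypass_isPath, fun hj => hq j (q.support_bypass_subset_support hj) (by simp)⟩
  have heq := (hT.isAcyclic.subsingleton_path j x).elim ⟨_, hpath⟩ ⟨p.bypass, p.bypass_isPath⟩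
  have hmem : i ∈ p.bypass.support := by
    rw [← congrArg (fun w : T.Path j x => (w : T.Walk j x).support) heq]
    simp
  exact hp i (p.support_bypass_subset_support hmem) (by simp)

/-- Some bag of a tree decomposition meets every connected set that contains more than half
of `W`. -/
theorem IsTreeDecomposition.exists_balanced_bag {ι : Type*} [Fintype ι]
    {T : SimpleGraph ι} {bag : ι → Finset V} (hT : IsTreeDecomposition G T bag) (W : Finset V) :
    ∃ i, ∀ H, IsConnSet G H → Disjoint H (bag i) → 2 * (H ∩ W).card ≤ W.card := by
  classical
  by_contra! hcon
  choose H hconn hdisj hheavy using hcon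
  -- If every bag `i` misses a heavy connected set `H i`, then all bags meeting `H i` lie beyond a
  -- single neighbour `j` of `i`.
  have key : ∀ i, ∃ j, T.Adj i j ∧
      ∀ v ∈ H i, ∀ x, v ∈ bag x → ReachAvoiding T {i} j x := by
    intro i
    obtain ⟨v₀, hv₀⟩ := (hconn i).1
    obtain ⟨x₀, hx₀⟩ := hT.cover v₀
    have hni : ∀ v ∈ H i, v ∉ bag i := fun v hv => Finset.disjoint_left.1 (hdisj i) hv
    have hsame : ∀ v ∈ H i, ∀ x y, v ∈ bag x → v ∈ bag y → ReachAvoiding T {i} x y := by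
      intro v hv x y hx hy
      obtain ⟨p⟩ := hT.isTree.connected.preconnected x y
      refine ⟨p.bypass, fun z hz hzi => hni v hv ?_⟩
      rw [Finset.mem_singleton] at hzi
      exact hzi ▸ hT.path v x y hx hy _ p.bypass_isPath z hz
    have hix : i ≠ x₀ := by
      rintro rfl
      exact hni v₀ hv₀ hx₀
    obtain ⟨p⟩ := hT.isTree.connected.preconnected i x₀
    obtain ⟨j, hij, hj⟩ : ∃ j, T.Adj i j ∧ ReachAvoiding T {i} j x₀ := by
      have hp := p.bypass_isPath
      cases hq : p.bypass with
      | nil => exact absurd rfl hix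
      | cons h q =>
        rw [hq, SimpleGraph.Walk.cons_isPath_iff] at hp
        refine ⟨_, h, q, fun z hz hzi => hp.2 ?_⟩
        rw [Finset.mem_singleton] at hzi
        exact hzi ▸ hz
    refine ⟨j, hij, ?_⟩
    -- Adjacent vertices share a bag, so lying beyond `j` propagates along the edges inside `H i`.
    have hsub := (hconn i).2
      ((H i).filter fun v => ∀ x, v ∈ bag x → ReachAvoiding T {i} j x)
      (Finset.filter_subset _ _)
      ⟨v₀, Finset.mem_filter.2 ⟨hv₀, fun x hx => hj.trans (hsame v₀ hv₀ _ _ hx₀ hx)⟩⟩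
      (fun u hu v hv huv => by
        rw [Finset.mem_filter] at hu ⊢
        obtain ⟨y, hy, hy'⟩ := hT.edge u v huv
        exact ⟨hv, fun x hx => (hu.2 y hy).trans (hsame v hv _ _ hy' hx)⟩)
    exact fun v hv => (Finset.mem_filter.1 (hsub hv)).2
  choose f hf hreach using key
  obtain ⟨i, hi⟩ := hT.isTree.exists_swap f hf
  -- Two sets that each contain more than half of `W` meet. A bag holding a common vertex would lie
  -- on both sides of the swapped edge.
  obtain ⟨v, hv⟩ : (H i ∩ W ∩ (H (f i) ∩ W)).Nonempty := by
    by_contra hne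
    have hd : Disjoint (H i ∩ W) (H (f i) ∩ W) :=
      Finset.disjoint_iff_inter_eq_empty.2 (Finset.not_nonempty_iff_eq_empty.1 hne)
    have hle := Finset.card_le_card
      (Finset.union_subset (Finset.inter_subset_right (s₁ := H i) (s₂ := W))
        (Finset.inter_subset_right (s₁ := H (f i)) (s₂ := W)))
    rw [Finset.card_union_of_disjoint hd] at hle
    have h1 := hheavy i
    have h2 := hheavy (f i)
    omega
  simp only [Finset.mem_inter] at hv
  obtain ⟨x, hx⟩ := hT.cover v
  have h1 := hreach i v hv.1.1 x hx
  have h2 := hreach (f i) v hv.2.1 x hx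
  rw [hi] at h2
  exact hT.isTree.not_reachAvoiding_both (hf i) h1 h2

/-- If all fibres of `f` on `W` contain at most half of `W`, then some union of fibres contains
between a third and two thirds of `W`. -/
theorem exists_balanced_fibers {α β : Type*} [DecidableEq β] (W : Finset α) (hW : W.Nonempty)
    (f : α → β) (hf : ∀ b, 2 * (W.filter fun a => f a = b).card ≤ W.card) :
    ∃ L : Finset β, W.card ≤ 3 * (W.filter fun a => f a ∈ L).card ∧
      3 * (W.filter fun a => f a ∈ L).card ≤ 2 * W.card := by
  classical
  have hex : ((W.image f).powerset.filter
      fun L => W.card ≤ 3 * (W.filter fun a => f a ∈ L).card).Nonempty := by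
    refine ⟨W.image f, Finset.mem_filter.2 ⟨Finset.mem_powerset_self _, ?_⟩⟩
    rw [Finset.filter_true_of_mem fun a ha => Finset.mem_image_of_mem f ha]
    omega
  -- With `L` as small as possible, one fibre suffices (at most half of `W`), or `L` splits into two
  -- parts that each carry less than a third.
  obtain ⟨L, hL, hmin⟩ := Finset.exists_min_image _ Finset.card hex
  rw [Finset.mem_filter, Finset.mem_powerset] at hL
  have hpos := hW.card_pos
  have hmin' : ∀ L' ⊆ L, L'.card < L.card → 3 * (W.filter fun a => f a ∈ L').card < W.card := by
    intro L' hL' hlt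
    by_contra! hge
    have := hmin L' (Finset.mem_filter.2 ⟨Finset.mem_powerset.2 (hL'.trans hL.1), hge⟩)
    omega
  refine ⟨L, hL.2, ?_⟩
  obtain ⟨b, hb⟩ : L.Nonempty := by
    by_contra hne
    rw [Finset.not_nonempty_iff_eq_empty] at hne
    have := hL.2
    simp only [hne, Finset.notMem_empty, Finset.filter_false, Finset.card_empty] at this
    omega
  have hsplit : (W.filter fun a => f a ∈ L) ⊆
      (W.filter fun a => f a = b) ∪ W.filter fun a => f a ∈ L.erase b := by
    intro a ha
    simp only [Finset.mem_filter, Finset.mem_union, Finset.mem_erase] at ha ⊢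
    tauto
  have hle := (Finset.card_le_card hsplit).trans (Finset.card_union_le _ _)
  have herase := hmin' _ (Finset.erase_subset b L) (Finset.card_erase_lt_of_mem hb)
  have hfb := hf b
  rcases Nat.lt_or_ge 1 L.card with h1 | h1
  · have hs := hmin' {b} (Finset.singleton_subset_iff.2 hb) (by simpa using h1)
    simp only [Finset.mem_singleton] at hs
    omega
  · have hLb : L.erase b = ∅ := by
      rw [← Finset.card_eq_zero, Finset.card_erase_of_mem hb]
      omega
    simp only [hLb, Finset.notMem_empty, Finset.filter_false, Finset.card_empty] at hle
    omega

theorem exists_balancedSplit_separates {k : ℕ} (htw : treewidth G ≤ k) (W : Finset V)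
    (hW : 2 ≤ W.card) :
    ∃ A B S : Finset V, IsBalancedSplit W A B ∧ Separates G A B S ∧ S.card ≤ k + 1 := by
  classical
  obtain ⟨n, T, bag, hT, hbag⟩ := exists_isTreeDecomposition_of_treewidth_le htw
  obtain ⟨i, hi⟩ := hT.exists_balanced_bag W
  set S := bag i with hS
  -- The key of `v` is its component if `v ∉ S`, and `{v}` if `v ∈ S`, where `compAvoiding` is
  -- empty. Singleton fibres are at most half of `W` because `|W| ≥ 2`.
  obtain ⟨L, hL1, hL2⟩ := exists_balanced_fibers W (Finset.card_pos.1 (by omega))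
    (fun v => insert v (compAvoiding G S v)) (by
      intro b
      rcases (W.filter fun a => insert a (compAvoiding G S a) = b).eq_empty_or_nonempty
        with h | ⟨v, hv⟩
      · rw [h]; simp
      · rw [Finset.mem_filter] at hv
        by_cases hvS : v ∈ S
        · have hsub : (W.filter fun a => insert a (compAvoiding G S a) = b) ⊆ {v} := by
            intro a ha
            rw [Finset.mem_filter, ← hv.2] at ha
            have hv0 : compAvoiding G S v = ∅ :=
              Finset.eq_empty_of_forall_notMem fun x hx =>
                (mem_compAvoiding.1 hx).symm.notMem hvS
            have := Finset.mem_insert_self a (compAvoiding G S a)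
            rw [ha.2, hv0] at this
            simpa using this
          have := Finset.card_le_card hsub
          rw [Finset.card_singleton] at this
          omega
        · have hsub : (W.filter fun a => insert a (compAvoiding G S a) = b) ⊆
              compAvoiding G S v ∩ W := by
            intro a ha
            rw [Finset.mem_filter, ← hv.2] at ha
            have := Finset.mem_insert_self a (compAvoiding G S a)
            rw [ha.2, Finset.insert_eq_of_mem (mem_compAvoiding.2 (reachAvoiding_self hvS))]
              at this
            exact Finset.mem_inter.2 ⟨this, ha.1⟩
          have h2 := hi _ (isConnSet_compAvoiding hvS) (disjoint_compAvoiding S v)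
          have := Finset.card_le_card hsub
          omega)
  have hcard := Finset.card_filter_add_card_filter_not (s := W)
    (fun v => insert v (compAvoiding G S v) ∈ L)
  refine ⟨W.filter fun v => insert v (compAvoiding G S v) ∈ L,
    W.filter fun v => insert v (compAvoiding G S v) ∉ L, S,
    ⟨⟨Finset.filter_union_filter_not_eq _ _, Finset.disjoint_filter_filter_not _ _ _⟩, ?_, ?_⟩,
    ?_, hbag i⟩
  · have : ((3 * (W.filter fun v => insert v (compAvoiding G S v) ∈ L).card : ℕ) : ℝ)
      ≤ (2 * W.card : ℕ) := by exact_mod_cast hL2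
    push_cast at this
    linarith
  · have : ((3 * (W.filter fun v => insert v (compAvoiding G S v) ∉ L).card : ℕ) : ℝ)
      ≤ (2 * W.card : ℕ) := by
        have : 3 * (W.filter fun v => insert v (compAvoiding G S v) ∉ L).card ≤ 2 * W.card := by
          omega
        exact_mod_cast this
    push_cast at this
    linarith
  · intro a ha b hb p _
    by_contra! hp
    rw [Finset.mem_filter] at ha hb
    have hr : ReachAvoiding G S a b := ⟨p, hp⟩
    have heq := compAvoiding_eq hr
    rw [Finset.insert_eq_of_mem (mem_compAvoiding.2 (reachAvoiding_self hr.symm.notMem))] at ha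
    rw [Finset.insert_eq_of_mem (mem_compAvoiding.2 (reachAvoiding_self hr.notMem)), ← heq] at hb
    exact hb.2 ha.2

end Treewidth

/-! ### Covering the complements of huge components by few sets -/

section Cover

variable {V : Type*} [DecidableEq V] {G : SimpleGraph V}

/-- A connected set with a marked vertex `r` and at least one more vertex splits into two connected
sets, of which the second one contains `r` and the first one a neighbour of `r`. -/
theorem IsConnSet.exists_split {P : Finset V} (hP : IsConnSet G P) {r : V} (hr : r ∈ P)
    (hcard : 2 ≤ P.card) :
    ∃ Q ⊆ P, r ∉ Q ∧ IsConnSet G Q ∧ IsConnSet G (P \ Q) ∧ ∃ r' ∈ Q, G.Adj r r' := by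
  classical
  obtain ⟨r', hr'P, hr'r, hadj⟩ : ∃ r' ∈ P, r' ≠ r ∧ G.Adj r r' := by
    by_contra! hno
    have := hP.2 {r} (by simpa using hr) (Finset.singleton_nonempty r) (by
      intro x hx y hy hxy
      rw [Finset.mem_singleton] at hx ⊢
      subst hx
      by_contra hyr
      exact hno y hy hyr hxy)
    have := Finset.card_le_card this
    rw [Finset.card_singleton] at this
    omega
  -- A largest such `Q` is the component of `r'` in `P \ {r}`, so its edges to the rest of `P` all
  -- end in `r`.
  obtain ⟨Q, hQ, hmax⟩ := Finset.exists_max_image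
    (P.powerset.filter fun Q => r ∉ Q ∧ r' ∈ Q ∧ IsConnSet G Q) Finset.card
    ⟨{r'}, by simp [hr'P, hr'r.symm, isConnSet_singleton]⟩
  simp only [Finset.mem_filter, Finset.mem_powerset] at hQ hmax
  obtain ⟨hQP, hrQ, hr'Q, hconn⟩ := hQ
  have hno : ∀ x ∈ Q, ∀ y ∈ P, y ≠ r → G.Adj x y → y ∈ Q := by
    intro x hx y hy hyr hxy
    by_contra hyQ
    have := hmax (insert y Q) ⟨Finset.insert_subset hy hQP, by simp [hrQ, hyr.symm],
      Finset.mem_insert_of_mem hr'Q, hconn.insert_of_adj hx hxy⟩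
    rw [Finset.card_insert_of_notMem hyQ] at this
    omega
  have hrR : r ∈ P \ Q := Finset.mem_sdiff.2 ⟨hr, hrQ⟩
  refine ⟨Q, hQP, hrQ, hconn, ⟨⟨r, hrR⟩, fun T hT hne hcl => ?_⟩, r', hr'Q, hadj⟩
  by_cases hrT : r ∈ T
  · have := hP.2 (T ∪ Q) (Finset.union_subset (hT.trans Finset.sdiff_subset) hQP)
      (hne.mono Finset.subset_union_left) (by
        intro x hx y hy hxy
        by_cases hyr : y = r
        · exact Finset.mem_union_left _ (hyr ▸ hrT)
        rcases Finset.mem_union.1 hx with hx | hx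
        · by_cases hyQ : y ∈ Q
          · exact Finset.mem_union_right _ hyQ
          · exact Finset.mem_union_left _ (hcl x hx y (Finset.mem_sdiff.2 ⟨hy, hyQ⟩) hxy)
        · exact Finset.mem_union_right _ (hno x hx y hy hyr hxy))
    intro y hy
    rw [Finset.mem_sdiff] at hy
    exact (Finset.mem_union.1 (this hy.1)).resolve_right hy.2
  · have := hP.2 T (hT.trans Finset.sdiff_subset) hne (by
        intro x hx y hy hxy
        have hx' := Finset.mem_sdiff.1 (hT hx)
        refine hcl x hx y (Finset.mem_sdiff.2 ⟨hy, fun hyQ => hx'.2 ?_⟩) hxy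
        exact hno y hyQ x hx'.1 (fun h => hrT (h ▸ hx)) hxy.symm)
    exact absurd (this hr) hrT

/-- A connected set `K` has a connected subset of size between `s` and `2s` that is joined to the
rest of `K` in a single vertex `r`. -/
theorem IsConnSet.exists_piece {K : Finset V} (hK : IsConnSet G K) {s : ℕ} (hs : 1 ≤ s)
    (hsK : s ≤ K.card) :
    ∃ P ⊆ K, ∃ r ∈ P, IsConnSet G P ∧ IsConnSet G (insert r (K \ P)) ∧
      s ≤ P.card ∧ P.card ≤ 2 * s := by
  classical
  obtain ⟨r₀, hr₀⟩ := hK.1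
  -- Take a smallest admissible `P`. If it had more than `2s` elements, splitting it at `r` would
  -- leave a part with at least `s` elements: `Q` with the new root `r'`, or `P \ Q` with `r`.
  obtain ⟨P, hP, hmin⟩ := Finset.exists_min_image
    (K.powerset.filter fun P => ∃ r ∈ P, IsConnSet G P ∧ IsConnSet G (insert r (K \ P)) ∧
      s ≤ P.card) Finset.card
    ⟨K, Finset.mem_filter.2 ⟨Finset.mem_powerset_self K, r₀, hr₀, hK, by
      simpa using isConnSet_singleton r₀, hsK⟩⟩
  simp only [Finset.mem_filter, Finset.mem_powerset] at hP hmin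
  obtain ⟨hPK, r, hrP, hconn, hrest, hsP⟩ := hP
  refine ⟨P, hPK, r, hrP, hconn, hrest, hsP, ?_⟩
  by_contra! hlt
  obtain ⟨Q, hQP, hrQ, hQ, hPQ, r', hr'Q, hadj⟩ := hconn.exists_split hrP (by omega)
  have hrPQ : r ∈ P \ Q := Finset.mem_sdiff.2 ⟨hrP, hrQ⟩
  have hsub := Finset.card_sdiff_of_subset hQP
  have hlePQ := Finset.card_le_card hQP
  have hQpos := hQ.1.card_pos
  have hPQpos := hPQ.1.card_pos
  by_cases hsQ : s ≤ Q.card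
  · have := hmin Q ⟨hQP.trans hPK, r', hr'Q, hQ, ?_, hsQ⟩
    · omega
    · have h1 := (hrest.union hPQ (Finset.mem_insert_self _ _) hrPQ).insert_of_adj
        (Finset.mem_union_right _ hrPQ) hadj
      convert h1 using 2
      ext x
      simp only [Finset.mem_sdiff, Finset.mem_union, Finset.mem_insert]
      have := @hQP x
      have := @hPK x
      by_cases hxr : x = r
      · subst hxr; simp [hrP, hrQ, hPK hrP]
      · tauto
  · have := hmin (P \ Q) ⟨Finset.sdiff_subset.trans hPK, r, hrPQ, hPQ, ?_, by omega⟩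
    · omega
    · have h1 := hrest.union (hQ.insert_of_adj hr'Q hadj.symm) (Finset.mem_insert_self _ _)
        (Finset.mem_insert_self _ _)
      convert h1 using 2
      ext x
      simp only [Finset.mem_sdiff, Finset.mem_union, Finset.mem_insert]
      have := @hQP x
      have := @hPK x
      tauto

/-- A connected set is covered by few connected pieces of size at most `2s`, any two of which
meet only in a small set `R`. -/
theorem IsConnSet.exists_pieces {s : ℕ} (hs : 2 ≤ s) (K : Finset V) (hK : IsConnSet G K) :
    ∃ (𝓟 : Finset (Finset V)) (R : Finset V),
      (∀ P ∈ 𝓟, P ⊆ K ∧ IsConnSet G P ∧ P.card ≤ 2 * s) ∧ (∀ x ∈ K, ∃ P ∈ 𝓟, x ∈ P) ∧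
      R ⊆ K ∧ (∀ P ∈ 𝓟, ∀ Q ∈ 𝓟, P ≠ Q → P ∩ Q ⊆ R) ∧
      𝓟.card * (s - 1) ≤ K.card + (s - 1) ∧ R.card * (s - 1) ≤ K.card := by
  classical
  induction hn : K.card using Nat.strong_induction_on generalizing K with
  | _ n ih =>
  subst hn
  by_cases hsmall : K.card ≤ 2 * s
  · refine ⟨{K}, ∅, by simpa using ⟨hK, hsmall⟩, by simp, by simp, ?_, by simp, by simp⟩
    intro P hP Q hQ hne
    rw [Finset.mem_singleton] at hP hQ
    exact absurd (hP.trans hQ.symm) hne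
  obtain ⟨P, hPK, r, hrP, hP, hrest, hsP, hP2⟩ := hK.exists_piece (s := s) (by omega) (by omega)
  have hcard : (insert r (K \ P)).card + P.card = K.card + 1 := by
    rw [Finset.card_insert_of_notMem (by simp [hrP]), Finset.card_sdiff_of_subset hPK]
    have := Finset.card_le_card hPK
    omega
  have hsubK : insert r (K \ P) ⊆ K := Finset.insert_subset (hPK hrP) Finset.sdiff_subset
  -- The rest keeps `r`, so it loses `|P| - 1 ≥ s - 1` elements; this is what the counts charge for
  -- each piece, and `s ≥ 2` makes it a decrease.
  obtain ⟨𝓟, R, h1, h2, h3, h4, h5, h6⟩ := ih _ (by omega) (insert r (K \ P)) hrest rfl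
  have hPQ : ∀ Q ∈ 𝓟, P ∩ Q ⊆ insert r R := by
    intro Q hQ x hx
    rw [Finset.mem_inter] at hx
    rcases Finset.mem_insert.1 ((h1 Q hQ).1 hx.2) with h | h
    · exact h ▸ Finset.mem_insert_self _ _
    · exact absurd hx.1 (Finset.mem_sdiff.1 h).2
  refine ⟨insert P 𝓟, insert r R, ?_, ?_, Finset.insert_subset (hPK hrP) (h3.trans hsubK),
    ?_, ?_, ?_⟩
  · intro Q hQ
    rcases Finset.mem_insert.1 hQ with rfl | hQ
    · exact ⟨hPK, hP, hP2⟩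
    · exact ⟨(h1 Q hQ).1.trans hsubK, (h1 Q hQ).2⟩
  · intro x hx
    by_cases hxP : x ∈ P
    · exact ⟨P, Finset.mem_insert_self _ _, hxP⟩
    · obtain ⟨Q, hQ, hxQ⟩ := h2 x (Finset.mem_insert_of_mem (Finset.mem_sdiff.2 ⟨hx, hxP⟩))
      exact ⟨Q, Finset.mem_insert_of_mem hQ, hxQ⟩
  · intro Q hQ Q' hQ' hne
    rcases Finset.mem_insert.1 hQ with h | h <;> rcases Finset.mem_insert.1 hQ' with h' | h'
    · exact absurd (h.trans h'.symm) hne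
    · exact h ▸ hPQ Q' h'
    · rw [Finset.inter_comm]
      exact h' ▸ hPQ Q h
    · exact (h4 Q h Q' h' hne).trans (Finset.subset_insert _ _)
  · have := Nat.mul_le_mul_right (s - 1) (Finset.card_insert_le P 𝓟)
    rw [Nat.add_mul, Nat.one_mul] at this
    omega
  · have := Nat.mul_le_mul_right (s - 1) (Finset.card_insert_le r R)
    rw [Nat.add_mul, Nat.one_mul] at this
    omega

/-- The number of members of a family that meet `S` is at most `|S|` if no element of `S` is in two
members. -/
theorem card_filter_inter_nonempty_le {𝓟 : Finset (Finset V)} {R S : Finset V}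
    (h : ∀ P ∈ 𝓟, ∀ Q ∈ 𝓟, P ≠ Q → P ∩ Q ⊆ R) (hRS : Disjoint R S) :
    (𝓟.filter fun P => (P ∩ S).Nonempty).card ≤ S.card := by
  classical
  rcases S.eq_empty_or_nonempty with rfl | ⟨x₀, -⟩
  · simp
  have : Nonempty V := ⟨x₀⟩
  have hch : ∀ P ∈ 𝓟.filter (fun P => (P ∩ S).Nonempty), ∃ x, x ∈ P ∩ S := fun P hP =>
    (Finset.mem_filter.1 hP).2
  choose! f hf using hch
  refine Finset.card_le_card_of_injOn f (fun P hP => (Finset.mem_inter.1 (hf P hP)).2) ?_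
  intro P hP Q hQ hPQ
  by_contra hne
  have h1 := Finset.mem_inter.1 (hf P hP)
  have h2 := Finset.mem_inter.1 (hf Q hQ)
  rw [← hPQ] at h2
  exact Finset.disjoint_left.1 hRS (h P (Finset.mem_filter.1 hP).1 Q (Finset.mem_filter.1 hQ).1 hne
    (Finset.mem_inter.2 ⟨h1.1, h2.1⟩)) h1.2

variable [Fintype V]

/-- A family of at most `2 ^ q * (q + 1) ^ b` sets such that the complement of any component of
`G \ S` with more than half of the vertices is contained in a slightly larger member of the
family, provided that `|S ∩ Z| ≤ b` and that the component lies in `Z`. -/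
theorem exists_covering_family (G : SimpleGraph V) {s q : ℕ} (hs : 2 ≤ s)
    (hq : ∀ x : ℕ, x * (s - 1) ≤ Fintype.card V + (s - 1) → x ≤ q) (b : ℕ) :
    ∀ Z : Finset V, ∃ 𝓕 : Finset (Finset V), 𝓕.card ≤ 2 ^ q * (q + 1) ^ b ∧
      ∀ S C : Finset V, (S ∩ Z).card ≤ b → IsConnSet G C → C ⊆ Z → Disjoint C S →
        (∀ x ∈ C, ∀ y, G.Adj x y → y ∉ S → y ∈ C) → Fintype.card V < 2 * C.card →
        ∃ E ∈ 𝓕, Cᶜ ⊆ E ∧ E.card ≤ Cᶜ.card + S.card * (2 * s) := by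
  classical
  induction b using Nat.strong_induction_on with
  | _ b ih =>
  intro Z
  by_cases hex : (Z.powerset.filter
      fun K => IsConnSet G K ∧ Fintype.card V < 2 * K.card).Nonempty
  swap
  · refine ⟨∅, by simp, fun S C _ hC hCZ _ _ hbig => (hex ⟨C, ?_⟩).elim⟩
    exact Finset.mem_filter.2 ⟨Finset.mem_powerset.2 hCZ, hC, hbig⟩
  -- Connected sets with more than half of the vertices meet pairwise, so a largest one inside `Z`
  -- contains all the others.
  obtain ⟨K, hK, hmax⟩ := Finset.exists_max_image _ Finset.card hex
  simp only [Finset.mem_filter, Finset.mem_powerset] at hK hmax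
  obtain ⟨hKZ, hKc, hKbig⟩ := hK
  obtain ⟨𝓟, R, h1, h2, h3, h4, h5, h6⟩ := hKc.exists_pieces hs
  have hKn := Finset.card_le_univ K
  have hPq : 𝓟.card ≤ q := hq _ (by omega)
  have hRq : R.card ≤ q := hq _ (by omega)
  have hCK : ∀ C, IsConnSet G C → C ⊆ Z → Fintype.card V < 2 * C.card → C ⊆ K := by
    intro C hC hCZ hbig
    obtain ⟨v, hv⟩ : (C ∩ K).Nonempty := by
      by_contra hne
      have hd : Disjoint C K :=
        Finset.disjoint_iff_inter_eq_empty.2 (Finset.not_nonempty_iff_eq_empty.1 hne)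
      have := Finset.card_le_univ (C ∪ K)
      rw [Finset.card_union_of_disjoint hd] at this
      omega
    rw [Finset.mem_inter] at hv
    have hle := Finset.card_le_card (Finset.subset_union_right (s₁ := C) (s₂ := K))
    have := hmax (C ∪ K) ⟨Finset.union_subset hCZ hKZ, hC.union hKc hv.1 hv.2, by omega⟩
    have := Finset.eq_of_subset_of_card_le (Finset.subset_union_right (s₁ := C) (s₂ := K)) this
    rw [this]
    exact Finset.subset_union_left
  set base : Finset (Finset V) := 𝓟.powerset.image fun I => Kᶜ ∪ I.biUnion id with hbase
  have hbasecard : base.card ≤ 2 ^ q := by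
    refine Finset.card_image_le.trans ?_
    rw [Finset.card_powerset]
    exact Nat.pow_le_pow_right (by norm_num) hPq
  have hbaseprop : ∀ S C : Finset V, Disjoint R S → IsConnSet G C → C ⊆ Z → Disjoint C S →
      (∀ x ∈ C, ∀ y, G.Adj x y → y ∉ S → y ∈ C) → Fintype.card V < 2 * C.card →
      ∃ E ∈ base, Cᶜ ⊆ E ∧ E.card ≤ Cᶜ.card + S.card * (2 * s) := by
    intro S C hRS hC hCZ hCS hcl hbig
    have hsub := hCK C hC hCZ hbig
    -- A piece that misses `S` lies inside `C` or is disjoint from it. Hence only the at most `|S|`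
    -- pieces meeting `S` can add vertices of `C`.
    refine ⟨Kᶜ ∪ (𝓟.filter fun P => ¬ P ⊆ C).biUnion id, Finset.mem_image.2
      ⟨_, Finset.mem_powerset.2 (Finset.filter_subset _ _), rfl⟩, ?_, ?_⟩
    · intro x hx
      rw [Finset.mem_compl] at hx
      by_cases hxK : x ∈ K
      · obtain ⟨P, hP, hxP⟩ := h2 x hxK
        exact Finset.mem_union_right _ (Finset.mem_biUnion.2
          ⟨P, Finset.mem_filter.2 ⟨hP, fun h => hx (h hxP)⟩, hxP⟩)
      · exact Finset.mem_union_left _ (Finset.mem_compl.2 hxK)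
    · have hcover : Kᶜ ∪ (𝓟.filter fun P => ¬ P ⊆ C).biUnion id ⊆
          Cᶜ ∪ (𝓟.filter fun P => (P ∩ S).Nonempty).biUnion id := by
        intro x hx
        rcases Finset.mem_union.1 hx with hx | hx
        · exact Finset.mem_union_left _ (Finset.compl_subset_compl.2 hsub hx)
        · obtain ⟨P, hP, hxP⟩ := Finset.mem_biUnion.1 hx
          rw [Finset.mem_filter] at hP
          by_cases hPS : (P ∩ S).Nonempty
          · exact Finset.mem_union_right _ (Finset.mem_biUnion.2
              ⟨P, Finset.mem_filter.2 ⟨hP.1, hPS⟩, hxP⟩)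
          · refine Finset.mem_union_left _ (Finset.mem_compl.2 fun hxC => hP.2 ?_)
            refine (h1 P hP.1).2.1.subset_of_closed ⟨x, Finset.mem_inter.2 ⟨hxP, hxC⟩⟩
              fun a ha y hy hay => hcl a ha y hay fun hyS => hPS ⟨y, Finset.mem_inter.2 ⟨hy, hyS⟩⟩
      refine (Finset.card_le_card hcover).trans ((Finset.card_union_le _ _).trans ?_)
      refine Nat.add_le_add_left ((Finset.card_biUnion_le_card_mul _ _ (2 * s)
        fun P hP => (h1 P (Finset.mem_filter.1 hP).1).2.2).trans ?_) _
      exact Nat.mul_le_mul_right _ (card_filter_inter_nonempty_le h4 hRS)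
  rcases b with _ | b
  · refine ⟨base, by simpa using hbasecard, fun S C hb => hbaseprop S C ?_⟩
    have hSZ : S ∩ Z = ∅ := Finset.card_eq_zero.1 (Nat.le_zero.1 hb)
    exact Finset.disjoint_left.2 fun x hxR hxS => by
      have : x ∈ S ∩ Z := Finset.mem_inter.2 ⟨hxS, hKZ (h3 hxR)⟩
      simp [hSZ] at this
  -- If `S` contains some `ρ ∈ R`, then `C` avoids `ρ`: delete it from `Z`, which lowers the budget
  -- `b` by one. There are at most `q` choices of `ρ`.
  · have ih' := fun ρ => ih b (Nat.lt_succ_self b) (Z.erase ρ)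
    choose 𝓕 h𝓕card h𝓕 using ih'
    refine ⟨base ∪ R.biUnion 𝓕, ?_, fun S C hb hC hCZ hCS hcl hbig => ?_⟩
    · refine (Finset.card_union_le _ _).trans ?_
      have hR := (Finset.card_biUnion_le_card_mul R 𝓕 _ fun ρ _ => h𝓕card ρ).trans
        (Nat.mul_le_mul_right _ hRq)
      have hone : 1 ≤ (q + 1) ^ b := Nat.one_le_pow _ _ (Nat.succ_pos q)
      calc base.card + (R.biUnion 𝓕).card
          ≤ 2 ^ q * (q + 1) ^ b + q * (2 ^ q * (q + 1) ^ b) :=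
            Nat.add_le_add (hbasecard.trans (Nat.le_mul_of_pos_right _ hone)) hR
        _ = 2 ^ q * (q + 1) ^ (b + 1) := by ring
    · by_cases hRS : Disjoint R S
      · obtain ⟨E, hE, hE'⟩ := hbaseprop S C hRS hC hCZ hCS hcl hbig
        exact ⟨E, Finset.mem_union_left _ hE, hE'⟩
      · obtain ⟨ρ, hρR, hρS⟩ := Finset.not_disjoint_iff.1 hRS
        have hlt : (S ∩ Z.erase ρ).card < (S ∩ Z).card := by
          refine Finset.card_lt_card (Finset.ssubset_iff_of_subset
            (Finset.inter_subset_inter_left (Finset.erase_subset _ _)) |>.2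
            ⟨ρ, Finset.mem_inter.2 ⟨hρS, hKZ (h3 hρR)⟩, by simp⟩)
        obtain ⟨E, hE, hE'⟩ := h𝓕 ρ S C (by omega) hC
          (Finset.subset_erase.2 ⟨hCZ, fun h => Finset.disjoint_left.1 hCS h hρS⟩) hCS hcl hbig
        exact ⟨E, Finset.mem_union_right _ (Finset.mem_biUnion.2 ⟨ρ, hρR, hE⟩), hE'⟩

end Cover

/-! ### Tail bounds by counting samples -/

section Counting

variable {V : Type*} [Fintype V] [DecidableEq V]

theorem card_filter_card_image_le (m j : ℕ) (hj : j ≤ Fintype.card V) :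
    (Finset.univ.filter fun ω : Fin m → V => (Finset.univ.image ω).card ≤ j).card ≤
      (Fintype.card V).choose j * j ^ m := by
  classical
  have hsub : (Finset.univ.filter fun ω : Fin m → V => (Finset.univ.image ω).card ≤ j) ⊆
      (Finset.univ.powersetCard j).biUnion fun J : Finset V => Fintype.piFinset fun _ => J := by
    intro ω hω
    rw [Finset.mem_filter] at hω
    obtain ⟨J, hJ, hJc⟩ := Finset.exists_superset_card_eq hω.2 hj
    exact Finset.mem_biUnion.2 ⟨J, Finset.mem_powersetCard.2 ⟨Finset.subset_univ _, hJc⟩,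
      Fintype.mem_piFinset.2 fun i => hJ (Finset.mem_image_of_mem ω (Finset.mem_univ i))⟩
  refine (Finset.card_le_card hsub).trans ((Finset.card_biUnion_le_card_mul _ _ (j ^ m) ?_).trans ?_)
  · intro J hJ
    rw [Fintype.card_piFinset_const, (Finset.mem_powersetCard.1 hJ).2]
  · rw [Finset.card_powersetCard, Finset.card_univ]

/-- If `m ≥ 2 |V|`, then few samples of size `m` hit at most half of the vertices. -/
theorem card_filter_two_mul_card_image_le {m : ℕ} (hm : 2 * Fintype.card V ≤ m) :
    ((Finset.univ.filter fun ω : Fin m → V =>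
      2 * (Finset.univ.image ω).card ≤ Fintype.card V).card : ℝ) ≤
      Real.exp (-(m / 20)) * (Fintype.card V : ℝ) ^ m := by
  set n := Fintype.card V with hn
  have h1 : (Finset.univ.filter fun ω : Fin m → V => 2 * (Finset.univ.image ω).card ≤ n).card ≤
      2 ^ n * (n / 2) ^ m := by
    refine le_trans (Finset.card_le_card ?_) ((card_filter_card_image_le (V := V) m (n / 2)
      (Nat.div_le_self _ _)).trans (Nat.mul_le_mul_right _ (Nat.choose_le_two_pow _ _)))
    intro ω
    simp only [Finset.mem_filter, Finset.mem_univ, true_and]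
    omega
  have h2 : ((n / 2 : ℕ) : ℝ) ≤ n / 2 := by exact_mod_cast Nat.cast_div_le
  have h3 : (2 : ℝ) ^ n * (n / 2) ^ m ≤ Real.exp (-(m / 20)) * (n : ℝ) ^ m := by
    have hlog := Real.log_two_gt_d9
    -- Since `n ≤ m / 2`, the left side is at most `2 ^ (-m / 2)`.
    have h4 : (2 : ℝ) ^ n * (1 / 2) ^ m ≤ Real.exp (-(m / 20)) := by
      have e1 : (2 : ℝ) ^ n = Real.exp (n * Real.log 2) := by
        rw [Real.exp_nat_mul, Real.exp_log two_pos]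
      have e2 : (1 / 2 : ℝ) ^ m = Real.exp (m * -Real.log 2) := by
        rw [Real.exp_nat_mul, Real.exp_neg, Real.exp_log two_pos, one_div]
      rw [e1, e2, ← Real.exp_add, Real.exp_le_exp]
      have hm' : (2 * n : ℝ) ≤ m := by exact_mod_cast hm
      have hm0 : (0 : ℝ) ≤ m := Nat.cast_nonneg m
      nlinarith
    calc (2 : ℝ) ^ n * (n / 2) ^ m = 2 ^ n * (1 / 2) ^ m * (n : ℝ) ^ m := by
          rw [div_eq_mul_one_div, mul_pow]; ring
      _ ≤ _ := by gcongr
  calc _ ≤ ((2 ^ n * (n / 2) ^ m : ℕ) : ℝ) := by exact_mod_cast h1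
    _ = 2 ^ n * ((n / 2 : ℕ) : ℝ) ^ m := by push_cast; rfl
    _ ≤ 2 ^ n * ((n : ℝ) / 2) ^ m := by gcongr
    _ ≤ _ := h3

/-- If `m < 2 |V|`, then few samples of size `m` hit at most `3m/10` vertices. -/
theorem card_filter_ten_mul_card_image_le {m : ℕ} (hm : m < 2 * Fintype.card V) :
    ((Finset.univ.filter fun ω : Fin m → V =>
      10 * (Finset.univ.image ω).card ≤ 3 * m).card : ℝ) ≤
      Real.exp (-(m / 20)) * (Fintype.card V : ℝ) ^ m := by
  set n := Fintype.card V with hn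
  set j := 3 * m / 10 with hj
  have hj10 : 10 * j ≤ 3 * m := Nat.mul_div_le _ _
  have hjm : j ≤ m := by omega
  have hn0 : (0 : ℝ) < n := by exact_mod_cast (by omega : 0 < n)
  have h1 : (Finset.univ.filter fun ω : Fin m → V => 10 * (Finset.univ.image ω).card ≤ 3 * m).card ≤
      n.choose j * j ^ m := by
    refine le_trans (Finset.card_le_card ?_) (card_filter_card_image_le (V := V) m j (by omega))
    intro ω
    simp only [Finset.mem_filter, Finset.mem_univ, true_and]
    omega
  have hjr : (10 * j : ℝ) ≤ 3 * m := by exact_mod_cast hj10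
  have hmr : (m : ℝ) ≤ 2 * n := by exact_mod_cast hm.le
  have h2 : (j : ℝ) ^ j / j.factorial ≤ Real.exp j :=
    Real.pow_div_factorial_le_exp _ (Nat.cast_nonneg j) j
  have h3 : ((j : ℝ) / n) ≤ Real.exp (-(1 / 2)) := by
    have h5 : (j : ℝ) / n ≤ 3 / 5 := by
      rw [div_le_iff₀ hn0]
      linarith
    have h6 : (3 / 5 : ℝ) ≤ Real.exp (-(1 / 2)) := by
      have h7 : Real.exp (1 / 2) ≤ 5 / 3 := by
        have h8 : Real.exp (1 / 2) ^ 2 ≤ (5 / 3) ^ 2 := by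
          rw [← Real.exp_nat_mul]
          have := Real.exp_one_lt_d9
          norm_num at this ⊢
          linarith
        exact le_of_sq_le_sq h8 (by norm_num)
      rw [Real.exp_neg, show (3 / 5 : ℝ) = (5 / 3)⁻¹ by norm_num]
      exact inv_anti₀ (Real.exp_pos _) h7
    exact h5.trans h6
  -- The exponent obtained is `j - (m - j) / 2 = (3j - m) / 2`, at most `-m / 20` because `j ≤ 3m /
  -- 10`.
  calc _ ≤ ((n.choose j * j ^ m : ℕ) : ℝ) := by exact_mod_cast h1
    _ = (n.choose j : ℝ) * (j : ℝ) ^ m := by push_cast; rfl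
    _ ≤ (n : ℝ) ^ j / j.factorial * (j : ℝ) ^ m := by
        gcongr
        exact Nat.choose_le_pow_div j n
    _ = (j : ℝ) ^ j / j.factorial * ((j : ℝ) / n) ^ (m - j) * (n : ℝ) ^ m := by
        obtain ⟨l, hl⟩ := Nat.exists_eq_add_of_le hjm
        rw [hl, Nat.add_sub_cancel_left, pow_add, pow_add, div_pow]
        field_simp
    _ ≤ Real.exp j * Real.exp (-(1 / 2)) ^ (m - j) * (n : ℝ) ^ m := by
        gcongr
    _ ≤ _ := by
        gcongr
        rw [← Real.exp_nat_mul, ← Real.exp_add, Real.exp_le_exp, Nat.cast_sub hjm]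
        linarith

/-- Few samples of size `m` have a tenth of their entries in a given set that contains at most
`8%` of the vertices. -/
theorem card_filter_le_ten_mul_card_filter {m : ℕ} {E : Finset V}
    (hE : (E.card : ℝ) ≤ 8 / 100 * Fintype.card V) :
    ((Finset.univ.filter fun ω : Fin m → V =>
      m ≤ 10 * (Finset.univ.filter fun i => ω i ∈ E).card).card : ℝ) ≤
      Real.exp (-(11 / 5000 * m)) * (Fintype.card V : ℝ) ^ m := by
  classical
  set n := Fintype.card V with hn
  have hexp : Real.exp (1 / 5) ≤ 1 + 2215 / 10000 := by
    have := Real.exp_bound' (x := 1 / 5) (by norm_num) (by norm_num) (n := 5) (by norm_num)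
    simp only [Finset.sum_range_succ, Finset.sum_range_zero, Nat.factorial] at this
    norm_num at this ⊢
    linarith
  have hexp1 : 1 ≤ Real.exp (1 / 5) := Real.one_le_exp (by norm_num)
  -- Chernoff bound with parameter `1/5`: a bad sample has weight at least `exp (m / 50)`, while the
  -- mean weight of one draw is at most `1 + 0.08 * 0.2215 = 1.01772`. The gain `0.02 - 0.01772`
  -- exceeds `11/5000`.
  set g : V → ℝ := fun v => if v ∈ E then Real.exp (1 / 5) else 1 with hg
  have hsum : ∑ v, g v ≤ Real.exp (1772 / 100000) * n := by
    have h1 : ∑ v, g v = n + E.card * (Real.exp (1 / 5) - 1) := by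
      have : ∀ v, g v = 1 + if v ∈ E then Real.exp (1 / 5) - 1 else 0 := by
        intro v
        simp only [hg]
        split_ifs <;> ring
      simp only [this, Finset.sum_add_distrib, Finset.sum_ite_mem, Finset.univ_inter]
      simp only [Finset.sum_const, Finset.card_univ, nsmul_eq_mul, mul_one, ← hn]
    rw [h1]
    have h2 := Real.add_one_le_exp (1772 / 100000 : ℝ)
    have hn0 : (0 : ℝ) ≤ n := Nat.cast_nonneg n
    nlinarith [mul_le_mul hE (by linarith : Real.exp (1 / 5) - 1 ≤ 2215 / 10000)
      (by linarith) (by positivity)]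
  have hg0 : ∀ v, 0 ≤ g v := by
    intro v
    simp only [hg]
    split_ifs <;> positivity
  have hprod : ∀ ω : Fin m → V, ∏ i, g (ω i) =
      Real.exp (1 / 5) ^ (Finset.univ.filter fun i => ω i ∈ E).card := by
    intro ω
    rw [Finset.prod_ite]
    simp
  have hmain : ((Finset.univ.filter fun ω : Fin m → V =>
      m ≤ 10 * (Finset.univ.filter fun i => ω i ∈ E).card).card : ℝ) * Real.exp (m / 50) ≤
      (∑ v, g v) ^ m := by
    rw [Fintype.sum_pow, ← nsmul_eq_mul]
    refine (Finset.card_nsmul_le_sum _ (fun ω : Fin m → V => ∏ i, g (ω i)) _ ?_).trans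
      (Finset.sum_le_sum_of_subset_of_nonneg (Finset.filter_subset _ _)
        fun ω _ _ => Finset.prod_nonneg fun i _ => hg0 _)
    intro ω hω
    rw [hprod, ← Real.exp_nat_mul, Real.exp_le_exp]
    have : (m : ℝ) ≤ 10 * (Finset.univ.filter fun i => ω i ∈ E).card := by
      exact_mod_cast (Finset.mem_filter.1 hω).2
    linarith
  have hfin : (∑ v, g v) ^ m ≤ Real.exp (1772 / 100000 * m) * (n : ℝ) ^ m := by
    calc (∑ v, g v) ^ m ≤ (Real.exp (1772 / 100000) * n) ^ m :=
          pow_le_pow_left₀ (Finset.sum_nonneg fun v _ => hg0 v) hsum m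
      _ = _ := by rw [mul_pow, ← Real.exp_nat_mul, mul_comm (m : ℝ)]
  have hle := hmain.trans hfin
  rw [← le_div_iff₀ (Real.exp_pos _)] at hle
  refine hle.trans ?_
  rw [mul_div_right_comm, ← Real.exp_sub]
  gcongr
  have : (0 : ℝ) ≤ m := Nat.cast_nonneg m
  linarith

theorem card_image_inter_le_card_filter {V : Type*} [DecidableEq V] {m : ℕ} (ω : Fin m → V) (E : Finset V) :
    (Finset.univ.image ω ∩ E).card ≤ (Finset.univ.filter fun i => ω i ∈ E).card := by
  classical
  refine (Finset.card_le_card ?_).trans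
    (Finset.card_image_le (s := Finset.univ.filter fun i => ω i ∈ E) (f := ω))
  intro v hv
  obtain ⟨h1, h2⟩ := Finset.mem_inter.1 hv
  obtain ⟨i, -, rfl⟩ := Finset.mem_image.1 h1
  exact Finset.mem_image_of_mem ω (Finset.mem_filter.2 ⟨Finset.mem_univ i, h2⟩)

theorem le_uniform_toOuterMeasure_of_card_le {Ω : Type*} [Fintype Ω] [Nonempty Ω]
    {s : Set Ω} {bad : Finset Ω} {τ : ℝ} (hbad : (bad.card : ℝ) ≤ τ * Fintype.card Ω)
    (h : ∀ ω, ω ∉ bad → ω ∈ s) :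
    ENNReal.ofReal (1 - τ) ≤ (PMF.uniformOfFintype Ω).toOuterMeasure s := by
  classical
  rw [PMF.toOuterMeasure_uniformOfFintype_apply]
  rw [ENNReal.le_div_iff_mul_le (Or.inl (by simp)) (Or.inl (by simp))]
  have hcard : Fintype.card Ω ≤ Fintype.card s + bad.card := by
    rw [← Set.toFinset_card, ← Finset.card_univ]
    refine (Finset.card_le_card fun ω _ => ?_).trans (Finset.card_union_le _ _)
    by_cases hω : ω ∈ bad
    · exact Finset.mem_union_right _ hω
    · exact Finset.mem_union_left _ (Set.mem_toFinset.2 (h ω hω))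
  have hcard' : (Fintype.card Ω : ℝ) ≤ Fintype.card s + bad.card := by exact_mod_cast hcard
  rw [← ENNReal.ofReal_natCast (Fintype.card Ω), ← ENNReal.ofReal_natCast (Fintype.card s),
    ← ENNReal.ofReal_mul' (Nat.cast_nonneg _)]
  exact ENNReal.ofReal_le_ofReal (by linarith)

end Counting

/-! ### Numerical consequences of the sample size bound -/

section SampleSize

theorem sampleSizeBound_eq (k : ℕ) (τ : ℝ) :
    sampleSizeBound (11 * k) (1 / 24) τ =
      max (63360 * k * Real.log (50688 * k)) (1152 * Real.log (2 / τ)) := by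
  have e1 : 10 * (11 * (k : ℝ)) / (1 / 24) ^ 2 = 63360 * k := by ring
  have e2 : 8 * (11 * (k : ℝ)) / (1 / 24) ^ 2 = 50688 * k := by ring
  have e3 : (2 : ℝ) / (1 / 24) ^ 2 = 1152 := by norm_num
  rw [sampleSizeBound, e1, e2, e3]

theorem ten_le_log {k : ℕ} (hk : 1 ≤ k) : 10 ≤ Real.log (50688 * k) := by
  have hk' : (1 : ℝ) ≤ k := by exact_mod_cast hk
  rw [Real.le_log_iff_exp_le (by positivity)]
  have h1 : Real.exp 10 = Real.exp 1 ^ 10 := by rw [← Real.exp_nat_mul]; norm_num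
  have h2 : Real.exp 1 ^ 10 ≤ 2.72 ^ 10 :=
    pow_le_pow_left₀ (Real.exp_pos _).le (by linarith [Real.exp_one_lt_d9]) 10
  rw [h1]
  norm_num at h2 ⊢
  linarith

theorem exp_neg_le_of_le {c τ : ℝ} {m : ℕ} (hτ : 0 < τ) (hτ1 : τ < 1)
    (hm : 1152 * Real.log (2 / τ) ≤ m) (hc : 1 / 1000 ≤ c) :
    Real.exp (-(c * m)) ≤ τ / 2 := by
  rw [← Real.le_log_iff_exp_le (by positivity), ← inv_div, Real.log_inv, neg_le_neg_iff]
  have hlog : 0 ≤ Real.log (2 / τ) := Real.log_nonneg (by rw [le_div_iff₀ hτ]; linarith)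
  have hm0 : (0 : ℝ) ≤ m := Nat.cast_nonneg m
  nlinarith

/-- The family of `exists_covering_family`, with the parameters chosen such that it is small
compared to the sample size. -/
theorem exists_small_covering_family {V : Type*} [Fintype V] [DecidableEq V] (G : SimpleGraph V)
    {k m : ℕ} (hk : 1 ≤ k) (hm : 63360 * k * Real.log (50688 * k) ≤ m)
    (hmn : m < 2 * Fintype.card V) :
    ∃ 𝓕 : Finset (Finset V), (𝓕.card : ℝ) ≤ Real.exp (6 / 5000 * m) ∧
      (∀ E ∈ 𝓕, (E.card : ℝ) ≤ 8 / 100 * Fintype.card V) ∧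
      ∀ S C : Finset V, S.card ≤ k + 1 → IsConnSet G C → Disjoint C S →
        (∀ x ∈ C, ∀ y, G.Adj x y → y ∉ S → y ∈ C) → 0.93 * (Fintype.card V : ℝ) < C.card →
        ∃ E ∈ 𝓕, Cᶜ ⊆ E := by
  classical
  set n := Fintype.card V with hn
  have hL := ten_le_log hk
  set L := Real.log (50688 * k) with hLdef
  have hk' : (1 : ℝ) ≤ k := by exact_mod_cast hk
  have hkL : 10 * (k : ℝ) ≤ k * L := by nlinarith
  have hnk : 4000 * k ≤ n := by
    have : (m : ℝ) < 2 * n := by exact_mod_cast hmn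
    have : (4000 * k : ℝ) ≤ n := by nlinarith
    exact_mod_cast this
  -- With this `s`, the excess `|S| * 2s` of a covering set is at most `n / 100`, which raises `0.07
  -- n` to `0.08 n`.
  set s := n / (200 * (k + 1)) with hs
  have hs1 : 200 * (k + 1) * s ≤ n := Nat.mul_div_le _ _
  have hs2 : n < 200 * (k + 1) * (s + 1) := Nat.lt_mul_div_succ _ (by omega)
  have hsge : 2 ≤ s := by
    rw [hs, Nat.le_div_iff_mul_le (by omega)]
    omega
  -- With `t = s - 1`, one has `n < 200(k + 1)(t + 2) ≤ 400kt + 800k`. As `800k ≤ n / 5`, this gives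
  -- `n < 500kt`, whence `q = 500k + 1`.
  obtain ⟨𝓕, hcard, hF⟩ := exists_covering_family G (s := s) (q := 500 * k + 1) hsge (by
    intro x hx
    obtain ⟨t, ht⟩ : ∃ t, s = t + 1 := ⟨s - 1, by omega⟩
    rw [ht] at hs2 hx
    rw [Nat.add_sub_cancel] at hx
    by_contra! hlt
    have h1 : (500 * k + 2) * t ≤ x * t := Nat.mul_le_mul_right _ hlt
    have h2 : t ≤ k * t := Nat.le_mul_of_pos_left _ hk
    have h3 : (500 * k + 2) * t = 500 * (k * t) + 2 * t := by ring
    have h4 : 200 * (k + 1) * (t + 1 + 1) = 200 * (k * t) + 400 * k + 200 * t + 400 := by ring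
    omega) (k + 1) Finset.univ
  refine ⟨𝓕.filter fun E => (E.card : ℝ) ≤ 8 / 100 * n, ?_, fun E hE => (Finset.mem_filter.1 hE).2,
    fun S C hS hC hCS hcl hbig => ?_⟩
  · have h1 : ((𝓕.filter fun E => (E.card : ℝ) ≤ 8 / 100 * n).card : ℝ) ≤
        2 ^ (500 * k + 1) * ((500 * k + 1 + 1 : ℕ) : ℝ) ^ (k + 1) := by
      exact_mod_cast (Finset.card_filter_le _ _).trans hcard
    refine h1.trans ?_
    have h2 : (2 : ℝ) ^ (500 * k + 1) ≤ Real.exp ((500 * k + 1 : ℕ) * 1) := by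
      rw [Real.exp_nat_mul]
      exact pow_le_pow_left₀ two_pos.le (by linarith [Real.exp_one_gt_d9]) _
    have h3 : ((500 * k + 1 + 1 : ℕ) : ℝ) ^ (k + 1) ≤ Real.exp ((k + 1 : ℕ) * L) := by
      rw [Real.exp_nat_mul, hLdef, Real.exp_log (by positivity)]
      refine pow_le_pow_left₀ (Nat.cast_nonneg _) ?_ _
      push_cast
      linarith
    calc _ ≤ Real.exp ((500 * k + 1 : ℕ) * 1) * Real.exp ((k + 1 : ℕ) * L) := by gcongr
      _ ≤ _ := by
        -- Since `L ≥ 10`, the exponent is at most `50.1 kL + 2 kL`, below `6/5000 * 63360 kL`.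
        rw [← Real.exp_add, Real.exp_le_exp]
        push_cast
        nlinarith
  · have hcomp : ((Cᶜ : Finset V).card : ℝ) = n - C.card := by
      rw [Finset.card_compl, Nat.cast_sub (Finset.card_le_univ C)]
    obtain ⟨E, hE, hsub, hEc⟩ := hF S C ((Finset.card_le_card Finset.inter_subset_left).trans hS)
      hC (Finset.subset_univ C) hCS hcl (by
        have hn0 : (0 : ℝ) ≤ n := Nat.cast_nonneg n
        have : (n : ℝ) < 2 * C.card := by
          norm_num at hbig
          linarith
        exact_mod_cast this)
    refine ⟨E, Finset.mem_filter.2 ⟨hE, ?_⟩, hsub⟩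
    have h1 : 100 * (S.card * (2 * s)) ≤ n := by
      refine le_trans ?_ hs1
      calc 100 * (S.card * (2 * s)) ≤ 100 * ((k + 1) * (2 * s)) := by gcongr
        _ = 200 * (k + 1) * s := by ring
    have h2 : (E.card : ℝ) ≤ (Cᶜ : Finset V).card + (S.card * (2 * s) : ℕ) := by
      exact_mod_cast hEc
    have h3 : (100 * (S.card * (2 * s) : ℕ) : ℝ) ≤ n := by exact_mod_cast h1
    norm_num at hbig
    linarith

end SampleSize

/-! ### Correctness on a good sample, and the probability bound -/

section Main

variable {V : Type*} [Fintype V] [DecidableEq V] {G : SimpleGraph V}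

/-- A set that separates `A` and `B` does not leave a component that meets both. -/
theorem Separates.card_compAvoiding_inter_le {A B S : Finset V} (h : Separates G A B S) (v : V) :
    (compAvoiding G S v ∩ (A ∪ B)).card ≤ max A.card B.card := by
  classical
  by_cases hA : (compAvoiding G S v ∩ A).Nonempty
  · refine (Finset.card_le_card fun x hx => ?_).trans (le_max_left _ _)
    obtain ⟨a, ha⟩ := hA
    rw [Finset.mem_inter, mem_compAvoiding] at ha hx
    refine (Finset.mem_union.1 hx.2).resolve_right fun hxB => ?_
    obtain ⟨p, hp⟩ := ha.1.symm.trans hx.1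
    obtain ⟨w, hw, hwS⟩ := h.exists_mem_support ha.2 hxB p
    exact hp w hw hwS
  · refine (Finset.card_le_card fun x hx => ?_).trans (le_max_right _ _)
    rw [Finset.mem_inter] at hx
    exact (Finset.mem_union.1 hx.2).resolve_left fun hxA =>
      hA ⟨x, Finset.mem_inter.2 ⟨hx.1, hxA⟩⟩

/-- If the sampled set is large enough and meets every huge component of `G \ S` in more than two
thirds of its elements, then the procedure returns, and everything it returns is good. -/
theorem separatorReturns_isGoodSeparator {k : ℕ} (htw : treewidth G ≤ k)
    {cov : Matrix V V ℝ} (hgen : IsGeneric G cov) {m : ℕ} (ω : Fin m → V)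
    (hW : 3 * (k + 1) < (Finset.univ.image ω).card)
    (hcomp : ∀ (S : Finset V) (v : V), S.card ≤ k + 1 → v ∉ S →
      0.93 * (Fintype.card V : ℝ) < (compAvoiding G S v).card →
      3 * (Finset.univ.image ω ∩ (compAvoiding G S v)ᶜ).card < (Finset.univ.image ω).card) :
    (∃ S : Finset V, SeparatorReturns cov ω S) ∧
      ∀ S : Finset V, SeparatorReturns cov ω S →
        IsGoodSeparator G k (Finset.univ.image ω) S := by
  classical
  set W := Finset.univ.image ω with hWdef
  obtain ⟨A₀, B₀, S₀, hbal₀, hsep₀, hS₀⟩ := exists_balancedSplit_separates htw W (by omega)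
  constructor
  · obtain ⟨A, B, hAB⟩ := exists_isSearchResult cov ⟨A₀, B₀, hbal₀⟩
    obtain ⟨S, hS⟩ := exists_ABSeparatorReturns cov A B
    exact ⟨S, A, B, hAB, hS⟩
  rintro S ⟨A, B, hAB, hS⟩
  have hmin := hS.isMinSeparator hgen
  obtain ⟨hbal, hrank⟩ : IsBalancedSplit W A B ∧
      ∀ A' B' : Finset V, IsBalancedSplit W A' B' → subRank cov A B ≤ subRank cov A' B' := by
    rcases hAB with h | h
    · exact h
    · exact absurd ⟨A₀, B₀, hbal₀⟩ h.1
  have hScard : S.card ≤ k + 1 := by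
    rw [hmin.card_eq_subRank hgen]
    exact (hrank A₀ B₀ hbal₀).trans ((hsep₀.subRank_le hgen).trans hS₀)
  have hcard : A.card + B.card = W.card := by
    rw [← Finset.card_union_of_disjoint hbal.1.2, hbal.1.1]
  have hA : 3 * A.card ≤ 2 * W.card := by
    have : (3 * A.card : ℝ) ≤ 2 * W.card := by linarith [hbal.2.1]
    exact_mod_cast this
  have hB : 3 * B.card ≤ 2 * W.card := by
    have : (3 * B.card : ℝ) ≤ 2 * W.card := by linarith [hbal.2.2]
    exact_mod_cast this
  have hsdiff : ∀ X : Finset V, S.card < X.card → (X \ S).Nonempty := fun X hX =>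
    Finset.sdiff_nonempty.2 fun h => by
      have := Finset.card_le_card h
      omega
  -- Each part has at least `|W| / 3 > k + 1 ≥ |S|` elements, since the other has at most two
  -- thirds.
  refine ⟨⟨A, B, hbal, hmin, hsdiff A (by omega), hsdiff B (by omega)⟩, hScard, fun C => ?_⟩
  obtain ⟨v, hv, hC⟩ := ncard_supp_le_card_compAvoiding C
  refine le_trans (Nat.cast_le.2 hC) ?_
  by_contra! hbig
  have h1 := hcomp S v hScard hv hbig
  have h2 := hmin.1.card_compAvoiding_inter_le v
  rw [hbal.1.1, Finset.inter_comm] at h2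
  have h3 : (W ∩ compAvoiding G S v).card + (W ∩ (compAvoiding G S v)ᶜ).card = W.card := by
    rw [← Finset.sdiff_eq_inter_compl]
    exact Finset.card_inter_add_card_sdiff W _
  rcases le_max_iff.1 h2 with h | h <;> omega

end Main

/-- The `m` vertices are drawn independently and uniformly (with replacement), i.e. the sample is
uniform on `Fin m → V`; `m` is any number allowed by the bound with `r = 11 k`, `δ = 1/24`. With
probability at least `1 - τ` the procedure returns, and whatever it returns is good. -/
theorem mainTheorem9 {V : Type*} [Fintype V] [DecidableEq V] [Nonempty V]
    (G : SimpleGraph V) (k : ℕ) (htw : treewidth G ≤ k)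
    (hV : 6 * (k + 1) ≤ Fintype.card V)
    (cov : Matrix V V ℝ) (hcov : cov ∈ covMatrices G) (hgen : IsGeneric G cov)
    (τ : ℝ) (hτ0 : 0 < τ) (hτ1 : τ < 1)
    (m : ℕ) (hm : sampleSizeBound (11 * k) (1 / 24) τ ≤ m) :
    ENNReal.ofReal (1 - τ) ≤
      (PMF.uniformOfFintype (Fin m → V)).toOuterMeasure
        {ω | (∃ S : Finset V, SeparatorReturns cov ω S) ∧
          ∀ S : Finset V, SeparatorReturns cov ω S →
            IsGoodSeparator G k (Finset.univ.image ω) S} := by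
  classical
  rw [sampleSizeBound_eq, max_le_iff] at hm
  obtain ⟨hmk, hmτ⟩ := hm
  have hlog2 : Real.log 2 ≤ Real.log (2 / τ) :=
    Real.log_le_log two_pos (by rw [le_div_iff₀ hτ0]; linarith)
  have hm700 : 700 ≤ m := by
    have : (700 : ℝ) ≤ m := by linarith [Real.log_two_gt_d9]
    exact_mod_cast this
  have htail : Real.exp (-((m : ℝ) / 20)) ≤ τ / 2 := by
    have := exp_neg_le_of_le hτ0 hτ1 hmτ (c := 1 / 20) (by norm_num)
    rwa [one_div_mul_eq_div] at this
  set n := Fintype.card V with hn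
  have hΩ : (Fintype.card (Fin m → V) : ℝ) = (n : ℝ) ^ m := by simp [hn]
  have hpow : (0 : ℝ) ≤ (n : ℝ) ^ m := by positivity
  -- For `m < 2n` the covering family is needed, and its size is controlled because `n` is large
  -- compared with `k`. For `m ≥ 2n` the size of `W` settles everything.
  rcases Nat.lt_or_ge m (2 * n) with hmn | hmn
  · obtain ⟨𝓕, hcard, hsmall, hF⟩ : ∃ 𝓕 : Finset (Finset V),
        (𝓕.card : ℝ) ≤ Real.exp (6 / 5000 * m) ∧
        (∀ E ∈ 𝓕, (E.card : ℝ) ≤ 8 / 100 * Fintype.card V) ∧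
        ∀ (S : Finset V) (v : V), S.card ≤ k + 1 → v ∉ S →
          0.93 * (Fintype.card V : ℝ) < (compAvoiding G S v).card →
          ∃ E ∈ 𝓕, (compAvoiding G S v)ᶜ ⊆ E := by
      rcases Nat.eq_zero_or_pos k with rfl | hk
      -- For `k = 0` the first term of the sample bound is no help, but `G` has no edges: components
      -- are single vertices, too small as `n ≥ 6`.
      · refine ⟨∅, by simpa using (Real.exp_pos _).le, by simp, fun S v _ _ hbig => ?_⟩
        have h1 : compAvoiding G S v ⊆ {v} := fun u hu => by
          refine Finset.mem_singleton.2 ?_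
          have := (mem_compAvoiding.1 hu).mem_of_closed (T := {v})
            (fun x _ y hxy _ => absurd hxy (not_adj_of_treewidth_eq_zero htw x y))
            (Finset.mem_singleton_self v)
          exact Finset.mem_singleton.1 this
        have h2 : ((compAvoiding G S v).card : ℝ) ≤ 1 := by
          exact_mod_cast (Finset.card_le_card h1).trans_eq (Finset.card_singleton v)
        have h3 : (6 : ℝ) ≤ Fintype.card V := by exact_mod_cast hV
        norm_num at hbig
        linarith
      · obtain ⟨𝓕, h1, h2, h3⟩ := exists_small_covering_family G hk hmk hmn
        exact ⟨𝓕, h1, h2, fun S v hS hv hbig => h3 S _ hS (isConnSet_compAvoiding hv)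
          (disjoint_compAvoiding S v) (fun x hx y => compAvoiding_closed hx) hbig⟩
    have hkm : 10 * (k + 1) ≤ m := by
      rcases Nat.eq_zero_or_pos k with rfl | hk
      · omega
      · have hk' : (1 : ℝ) ≤ k := by exact_mod_cast hk
        have : (10 * (k + 1) : ℝ) ≤ m := by nlinarith [ten_le_log hk]
        exact_mod_cast this
    refine le_uniform_toOuterMeasure_of_card_le
      (bad := (Finset.univ.filter fun ω : Fin m → V =>
          10 * (Finset.univ.image ω).card ≤ 3 * m) ∪
        𝓕.biUnion fun E => Finset.univ.filter fun ω : Fin m → V =>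
          m ≤ 10 * (Finset.univ.filter fun i => ω i ∈ E).card) ?_ fun ω hω => ?_
    · have h1 := card_filter_ten_mul_card_image_le hmn
      have h2 : ((𝓕.biUnion fun E => Finset.univ.filter fun ω : Fin m → V =>
          m ≤ 10 * (Finset.univ.filter fun i => ω i ∈ E).card).card : ℝ) ≤
          𝓕.card * (Real.exp (-(11 / 5000 * m)) * (n : ℝ) ^ m) := by
        refine (Nat.cast_le.2 Finset.card_biUnion_le).trans ?_
        rw [Nat.cast_sum, ← nsmul_eq_mul]
        exact Finset.sum_le_card_nsmul _ _ _ fun E hE =>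
          card_filter_le_ten_mul_card_filter (hsmall E hE)
      -- The union bound costs `6/5000` of the Chernoff exponent `11/5000`; the remaining `1/1000`
      -- suffices for `τ / 2`.
      have h3 : 𝓕.card * (Real.exp (-(11 / 5000 * m)) * (n : ℝ) ^ m) ≤ τ / 2 * (n : ℝ) ^ m := by
        rw [← mul_assoc]
        refine mul_le_mul_of_nonneg_right ?_ hpow
        calc 𝓕.card * Real.exp (-(11 / 5000 * m))
            ≤ Real.exp (6 / 5000 * m) * Real.exp (-(11 / 5000 * m)) := by gcongr
          _ = Real.exp (-(1 / 1000 * m)) := by rw [← Real.exp_add]; ring_nf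
          _ ≤ τ / 2 := exp_neg_le_of_le hτ0 hτ1 hmτ le_rfl
      have h4 := mul_le_mul_of_nonneg_right htail hpow
      refine (Nat.cast_le.2 (Finset.card_union_le _ _)).trans ?_
      rw [hΩ, Nat.cast_add]
      linarith
    · simp only [Finset.mem_union, Finset.mem_filter, Finset.mem_univ, true_and,
        Finset.mem_biUnion, not_or, not_le, not_exists, not_and] at hω
      refine separatorReturns_isGoodSeparator htw hgen ω (by omega) fun S v hS hv hbig => ?_
      obtain ⟨E, hE, hsub⟩ := hF S v hS hv hbig
      have h1 := hω.2 E hE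
      have h2 := card_image_inter_le_card_filter ω E
      have h3 := Finset.card_le_card (Finset.inter_subset_inter_left
        (s := Finset.univ.image ω) hsub)
      omega
  · refine le_uniform_toOuterMeasure_of_card_le
      (bad := Finset.univ.filter fun ω : Fin m → V => 2 * (Finset.univ.image ω).card ≤ n)
      ?_ fun ω hω => ?_
    · refine (card_filter_two_mul_card_image_le hmn).trans ?_
      rw [hΩ]
      exact mul_le_mul_of_nonneg_right (by linarith) hpow
    · simp only [Finset.mem_filter, Finset.mem_univ, true_and, not_le] at hω
      refine separatorReturns_isGoodSeparator htw hgen ω (by omega) fun S v hS hv hbig => ?_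
      have h1 := Finset.card_le_card
        (Finset.inter_subset_right (s₁ := Finset.univ.image ω) (s₂ := (compAvoiding G S v)ᶜ))
      have h2 : ((compAvoiding G S v)ᶜ.card : ℝ) = n - (compAvoiding G S v).card := by
        rw [Finset.card_compl, Nat.cast_sub (Finset.card_le_univ _)]
      have h3 : (100 * (compAvoiding G S v)ᶜ.card : ℝ) ≤ 7 * n := by
        norm_num at hbig
        linarith
      have h4 : 100 * (compAvoiding G S v)ᶜ.card ≤ 7 * n := by exact_mod_cast h3
      omega
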